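/- **Setting.** For $d\ge 1$ let $h^*:\mathbb{R}^{2d}\to\{-1,1\}$, $h^*(x)=\operatorname{sign}\big(\sum_{i=1}^{d}x_i^2-\sum_{i=d+1}^{2d}x_i^2\big)$, where $\operatorname{sign}(0)=1$, and let $\mathcal P$ be the set of laws of $(x,h^*(x))$, where the law $P_X$ of $x$ ranges over all Borel probability measures on $\mathbb{R}^{2d}$. A (randomized) learning algorithm $\mathcal A$ maps each finite training sequence $S=(x_i,y_i)_{i=1}^n$ to a probability distribution on functions $h:\mathbb{R}^{2d}\to\{-1,1\}$, and $\mathrm{err}_P(\mathcal A(S))=\Pr[h(x)\ne y]$ over $(x,y)\sim P$ and $h\sim\mathcal A(S)$. It is *orthogonal equivariant* if $\mathcal A((gx_i,y_i)_{i})\circ g$ and $\mathcal A((x_i,y_i)_{i})$ have the same distribution for every orthogonal map $g$ of $\mathbb{R}^{2d}$ and every training sequence. The sample complexity $\mathcal N(\mathcal A,\mathcal P,\varepsilon,\delta)\in\mathbb N\cup\{\infty\}$ is the smallest $n$ such that for every $P\in\mathcal P$, with probability at least $1-\delta$ over $n$ i.i.d. samples $S$ from $P$, $\mathrm{err}_P(\mathcal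 A(S))\le\varepsilon$. A 2-layer convolutional network with filter width $k$, $r$ blocks of length $p$, $rp=D$, and a combined activation and pooling map $\sigma:\mathbb{R}^p\to\mathbb{R}$ has weights $W=(w,a,b)\in\mathbb{R}^k\times\mathbb{R}^r\times\mathbb{R}$ and computes, with indices starting at $0$, $$\mathrm{CNN}[W](x)=\sum_{i=0}^{r-1}a_i\,\sigma\big((w*x)_{pi},\dots,(w*x)_{pi+p-1}\big)+b,\qquad (w*x)_i=\sum_{j=0}^{k-1}w_jx_{(i-j)\bmod D}.$$ Below, $k=1$, $r=2$, $p=d$ and $\sigma(z)=\sum_l z_l^2$. Let $\mathcal F_{\mathrm{CNN}}=\{\operatorname{sign}(\mathrm{CNN}[W]) : W\}$. An algorithm is an $\mathrm{ERM}_{\mathrm{CNN}}$ if for every training sequence it outputs a hypothesis in $\mathcal F_{\mathrm{CNN}}$ with the least number of training mistakes among all of $\mathcal F_{\mathrm{CNN}}$ (ties broken arbitrarily). **Theorem 3.1.** There are universal constants $c,C>0$ such that for all $d\ge1$ the following hold. 1. For every orthogonal equivariant $\mathcal A$, all $0<\varepsilon\le\frac18$ and all $0<\delta\le\frac14$, $$\mathcal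 N(\mathcal A,\mathcal P,\varepsilon,\delta)\ \ge\ c\,\frac{d^2+\ln\frac1\delta}{\varepsilon}.$$ 2. For every $\mathrm{ERM}_{\mathrm{CNN}}$, all $0<\varepsilon\le\frac12$ and all $0<\delta<1$, $$\mathcal N(\mathrm{ERM}_{\mathrm{CNN}},\mathcal P,\varepsilon,\delta)\ \le\ \frac{C}{\varepsilon}\Big(\log\frac1\varepsilon+\log\frac1\delta\Big).$$ 3. $\mathrm{ERM}_{\mathrm{CNN}}$ is realized by gradient descent. Let $\ell:\mathbb{R}\to\mathbb{R}$ be convex, non-increasing and differentiable, with $\ell'$ Lipschitz on every half-line $[M,\infty)$, $\ell(0)\ge1$ and $\lim_{t\to\infty}\ell(t)=0$. Draw all entries of $W^{(0)}$ i.i.d. from $N(0,1)$. With probability one over $W^{(0)}$, for every finite training sequence $S=(x_i,y_i)_{i=1}^n$ with $y_i=h^*(x_i)$ for all $i$, there is $\eta_0>0$ (which may depend on $\ell$, $S$ and $W^{(0)}$) such that for every $\eta\in(0,\eta_0)$ the iterates $W^{(T)}$ of gradient descent on $L(W)=\sum_{i=1}^n\ell(y_i\,\mathrm{CNN}[W](x_i))$,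 with step size $\eta$ for the second layer $(a,b)$ and $0$ for the first layer $w$, satisfy $L(W^{(T)})\to0$, and for all sufficiently large $T$ the hypothesis $\operatorname{sign}(\mathrm{CNN}[W^{(T)}])$ has no training mistakes and is an empirical risk minimizer over $\mathcal F_{\mathrm{CNN}}$ on $S$. -/

import Mathlib

open MeasureTheory ProbabilityTheory Filter Topology
open scoped ENNReal

noncomputable section

namespace ConvSep

/-! ### Learning theory. Labels are the units `{1, -1}` of `ℤ`. -/

/-- The sign of a real number as a label in `{-1, 1}`, with `sign 0 = 1`. -/
def sgn (t : ℝ) : ℤˣ := if 0 ≤ t then 1 else -1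

/-- A sequence of `n` labelled training points. -/
abbrev Dataset (X : Type*) (n : ℕ) : Type _ := Fin n → X × ℤˣ

/-- A (randomized) learning algorithm maps every training sequence, of any length, to a probability
distribution on hypotheses `X → {-1, 1}` (function space carries the product σ-algebra). -/
abbrev LearningAlgorithm (X : Type*) : Type _ :=
  (n : ℕ) → Dataset X n → ProbabilityMeasure (X → ℤˣ)

/-- A deterministic algorithm, seen as a randomized one whose output is a point mass. -/
def deterministic {X : Type*} (A : (n : ℕ) → Dataset X n → (X → ℤˣ)) : LearningAlgorithm X :=
  fun n S => ⟨Measure.dirac (A n S), inferInstance⟩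

/-- `err_P(h) = Pr[h(x) ≠ y]` over `(x, y) ∼ P` and over the random hypothesis `h ∼ μ`. -/
def err {X : Type*} [MeasurableSpace X] (P : Measure (X × ℤˣ))
    (μ : ProbabilityMeasure (X → ℤˣ)) : ℝ≥0∞ :=
  ∫⁻ z, (μ : Measure (X → ℤˣ)) {h | h z.1 ≠ z.2} ∂P

/-- The `(ε, δ)`-sample complexity of `A` on the problem `Prob` (a set of joint distributions): the
smallest `n` such that for each `P ∈ Prob`, except with probability at most `δ` over `n` i.i.d.
samples from `P`, the error of the output is at most `ε`. It is `⊤` if there is no such `n`. -/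
def sampleComplexity {X : Type*} [MeasurableSpace X] (A : LearningAlgorithm X)
    (Prob : Set (Measure (X × ℤˣ))) (ε δ : ℝ) : ℕ∞ :=
  sInf ((fun n : ℕ => (n : ℕ∞)) '' {n : ℕ | ∀ P ∈ Prob,
    Measure.pi (fun _ : Fin n => P) {S : Dataset X n | ENNReal.ofReal ε < err P (A n S)}
      ≤ ENNReal.ofReal δ})

/-- The problem `{all distributions} ⋄ {h}`: the laws of `(x, h x)` where `x` follows an arbitrary
probability measure. -/
def allDistributions {X : Type*} [MeasurableSpace X] (h : X → ℤˣ) : Set (Measure (X × ℤˣ)) :=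
  {P | ∃ PX : Measure X, IsProbabilityMeasure PX ∧ P = PX.map (fun x => (x, h x))}

/-- Equivariance under the orthogonal group: for each data set `(xᵢ, yᵢ)` and each orthogonal `g`,
`A((g xᵢ, yᵢ)ᵢ) ∘ g` and `A((xᵢ, yᵢ)ᵢ)` have the same distribution in function space. -/
def OrthogonalEquivariant {m : ℕ} (A : LearningAlgorithm (EuclideanSpace ℝ (Fin m))) : Prop :=
  ∀ (g : EuclideanSpace ℝ (Fin m) ≃ₗᵢ[ℝ] EuclideanSpace ℝ (Fin m)) (n : ℕ)
    (S : Dataset (EuclideanSpace ℝ (Fin m)) n),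
    (A n (fun i => (g (S i).1, (S i).2)) : Measure (EuclideanSpace ℝ (Fin m) → ℤˣ)).map
        (fun h => h ∘ g)
      = (A n S : Measure (EuclideanSpace ℝ (Fin m) → ℤˣ))

/-- The target `h*(x) = sign (∑_{i ≤ d} xᵢ² - ∑_{i > d} xᵢ²)` on `ℝ^{2d}` (indices start at `0`). -/
def target (d : ℕ) (x : EuclideanSpace ℝ (Fin (2 * d))) : ℤˣ :=
  sgn ((∑ i : Fin (2 * d) with i.val < d, x i ^ 2)
    - ∑ i : Fin (2 * d) with d ≤ i.val, x i ^ 2)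

/-- The number of training mistakes of `h` on `S`. -/
def empiricalErrors {X : Type*} {n : ℕ} (S : Dataset X n) (h : X → ℤˣ) : ℕ :=
  (Finset.univ.filter fun i => h (S i).1 ≠ (S i).2).card

/-- `h` is an empirical risk minimizer over the class `F` for the data set `S`. -/
def IsEmpiricalRiskMinimizer {X : Type*} {n : ℕ} (F : Set (X → ℤˣ)) (S : Dataset X n)
    (h : X → ℤˣ) : Prop :=
  h ∈ F ∧ ∀ h' ∈ F, empiricalErrors S h ≤ empiricalErrors S h'

/-- `A` performs empirical risk minimization over `F` (ties are broken in an arbitrary way). -/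
def IsERM {X : Type*} (F : Set (X → ℤˣ)) (A : (n : ℕ) → Dataset X n → (X → ℤˣ)) : Prop :=
  ∀ (n : ℕ) (S : Dataset X n), IsEmpiricalRiskMinimizer F S (A n S)

/-! ### Two-layer convolutional networks with one channel -/

/-- Circular convolution `[w * x]_i = ∑_j w_j x_{(i - j) mod D}`, all indices starting at `0`
(`(D - 1) * j` is `-j` modulo `D`). -/
def conv {k D : ℕ} (w : Fin k → ℝ) (x : EuclideanSpace ℝ (Fin D)) (i : Fin D) : ℝ :=
  ∑ j : Fin k, w j * x ⟨((i : ℕ) + (D - 1) * (j : ℕ)) % D, Nat.mod_lt _ i.pos⟩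

/-- The weights `(w, a, b) ∈ ℝ^k × ℝ^r × ℝ`. -/
abbrev Weights (k r : ℕ) : Type := (Fin k → ℝ) × (Fin r → ℝ) × ℝ

/-- The 2-layer CNN `x ↦ ∑_{i < r} a_i σ([w * x]_{p i, …, p i + p - 1}) + b` on `ℝ^{r p}`, where
`σ` combines the elementwise non-linearity and the pooling. -/
def cnn {k r p : ℕ} (σ : (Fin p → ℝ) → ℝ) (W : Weights k r)
    (x : EuclideanSpace ℝ (Fin (r * p))) : ℝ :=
  ∑ i : Fin r, W.2.1 i * σ (fun l : Fin p => conv W.1 x (finProdFinEquiv (i, l))) + W.2.2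

/-- Square activation followed by sum pooling. -/
def squarePool {p : ℕ} (z : Fin p → ℝ) : ℝ := ∑ l, z l ^ 2

/-- The hypotheses `sign (CNN[W])`, for all weights `W`. -/
def cnnClass (k r p : ℕ) (σ : (Fin p → ℝ) → ℝ) :
    Set (EuclideanSpace ℝ (Fin (r * p)) → ℤˣ) :=
  {h | ∃ W : Weights k r, h = fun x => sgn (cnn σ W x)}

/-! ### Gradient descent -/

/-- The training loss `L(W) = ∑ᵢ ℓ(yᵢ CNN[W](xᵢ))`. -/
def trainLoss {k r p n : ℕ} (ℓ : ℝ → ℝ) (σ : (Fin p → ℝ) → ℝ)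
    (S : Dataset (EuclideanSpace ℝ (Fin (r * p))) n) (W : Weights k r) : ℝ :=
  ∑ i, ℓ ((((S i).2 : ℤ) : ℝ) * cnn σ W (S i).1)

/-- One step of gradient descent on the training loss with learning rate `η` for the second layer
`(a, b)` and learning rate `0` for the first layer `w`. -/
def gdStep {k r p n : ℕ} (ℓ : ℝ → ℝ) (σ : (Fin p → ℝ) → ℝ)
    (S : Dataset (EuclideanSpace ℝ (Fin (r * p))) n) (η : ℝ) (W : Weights k r) : Weights k r :=
  (W.1,
    fun i => W.2.1 i
      - η * deriv (fun t => trainLoss ℓ σ S (W.1, Function.update W.2.1 i t, W.2.2)) (W.2.1 i),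
    W.2.2 - η * deriv (fun t => trainLoss ℓ σ S (W.1, W.2.1, t)) W.2.2)

/-- Initialization of all weights by i.i.d. standard Gaussians. -/
def gaussianInit (k r : ℕ) : Measure (Weights k r) :=
  (Measure.pi fun _ => gaussianReal 0 1).prod
    ((Measure.pi fun _ => gaussianReal 0 1).prod (gaussianReal 0 1))

/-- Convex non-increasing surrogates `ℓ` of the 0-1 loss: `ℓ(0) ≥ 1`, `ℓ → 0` at `+∞`, and
`ℓ` is differentiable with a derivative that is Lipschitz on every half-line `[M, ∞)`. -/
structure IsSurrogateLoss (ℓ : ℝ → ℝ) : Prop where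
  convex : ConvexOn ℝ Set.univ ℓ
  antitone : Antitone ℓ
  one_le : 1 ≤ ℓ 0
  tendsto_zero : Tendsto ℓ atTop (𝓝 0)
  differentiable : Differentiable ℝ ℓ
  lipschitz_deriv : ∀ M : ℝ, ∃ K : NNReal, LipschitzOnWith K (deriv ℓ) (Set.Ici M)

end ConvSep

end

namespace ConvSep

/-! ### Gradient descent for convex losses of linear margins -/

section GradientDescent

variable {ℓ : ℝ → ℝ}

/-! Write `x = (u, v)` for the two halves of the input. All three claims come from how the target
looks in two coordinate systems.

Lower bound. For an orthogonal matrix `Q`, the rotation `(u, v) ↦ ((u + Q v) / √2, (u - Q v) / √2)`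
turns the target into `sgn (u ⬝ᵥ Q v)`, which at `(e_i, e_j)` is the sign of `Q i j`. Cayley
transforms of small skew matrices realize every sign pattern above the diagonal
(`exists_orthogonal_sgn_eq`), so the rotated targets shatter `d (d - 1) / 2` points. An equivariant
algorithm that learns the target learns all its rotations equally well (`Suffices.sum_weights_le`),
so the classical VC argument applies: put mass of order `ε` on the shattered points and the rest at
the origin, whose label no rotation changes. An unseen point is then misclassified with probability
one half on average over the labels (`Suffices.card_le`). The `log (1 / δ)` term comes from one
point that can take both labels (`Suffices.log_le`).

Upper bound. Every network in the class is a half-space in the three features `(‖u‖², ‖v‖², 1)`, and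
the target is one of them, so a minimizer is consistent with the sample. Radon-type linear
dependence and Sauer's lemma give at most `(2 n + 1) ^ 3` traces on `2 n` points, and a weighted
ghost-sample symmetrization (`measure_exists_consistent_mul_le`) bounds the failure probability by
`(2 n + 1) ^ 3 / (1 + ε) ^ n`. The dimension `d` never enters.

Gradient descent. With the first layer frozen at a nonzero value, the output is linear in `(a, b)`,
so training is convex optimization on separable data in three dimensions. The usual descent and
telescoping argument drives the loss to zero (`IsSurrogateLoss.exists_tendsto_zero`), and a loss
below `1 ≤ ℓ 0` leaves no mistakes. -/

theorem IsSurrogateLoss.tangent_le (hℓ : IsSurrogateLoss ℓ) (s t : ℝ) :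
    ℓ s + deriv ℓ s * (t - s) ≤ ℓ t := by
  rcases lt_trichotomy s t with h | rfl | h
  · have := hℓ.convex.deriv_le_slope (Set.mem_univ s) (Set.mem_univ t) h (hℓ.differentiable s)
    rw [slope_def_field, le_div_iff₀ (sub_pos.2 h)] at this
    linarith
  · simp
  · have := hℓ.convex.slope_le_deriv (Set.mem_univ t) (Set.mem_univ s) h (hℓ.differentiable s)
    rw [slope_def_field, div_le_iff₀ (sub_pos.2 h)] at this
    linarith

theorem IsSurrogateLoss.nonneg (hℓ : IsSurrogateLoss ℓ) (t : ℝ) : 0 ≤ ℓ t :=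
  hℓ.antitone.le_of_tendsto hℓ.tendsto_zero t

theorem IsSurrogateLoss.deriv_nonpos (hℓ : IsSurrogateLoss ℓ) (t : ℝ) : deriv ℓ t ≤ 0 :=
  hℓ.antitone.deriv_nonpos

/-- The slope at `0` is strictly negative, since a horizontal tangent would keep `ℓ` above `1`; the
tangent at `0` then grows linearly to the left. This confines sublevel sets to half-lines, where
`deriv ℓ` is Lipschitz. -/
theorem IsSurrogateLoss.exists_lower_bound (hℓ : IsSurrogateLoss ℓ) (B : ℝ) :
    ∃ M : ℝ, ∀ t, ℓ t ≤ B → M ≤ t := by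
  have hneg : deriv ℓ 0 < 0 := by
    refine lt_of_le_of_ne (hℓ.deriv_nonpos 0) fun h0 => ?_
    obtain ⟨t, ht⟩ := (hℓ.tendsto_zero.eventually (gt_mem_nhds one_pos)).exists
    have := hℓ.tangent_le 0 t
    rw [h0] at this
    linarith [hℓ.one_le]
  refine ⟨B / deriv ℓ 0, fun t ht => ?_⟩
  rw [div_le_iff_of_neg hneg]
  have := hℓ.tangent_le 0 t
  rw [sub_zero] at this
  linarith [hℓ.one_le]

/-- Using the tangent at `t` instead of integrating the derivative costs a factor: `K` replaces the
usual `K / 2`. -/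
theorem IsSurrogateLoss.le_quadratic (hℓ : IsSurrogateLoss ℓ) {M : ℝ} {K : NNReal}
    (hK : LipschitzOnWith K (deriv ℓ) (Set.Ici M)) {s t : ℝ} (hs : M ≤ s) (ht : M ≤ t) :
    ℓ t ≤ ℓ s + deriv ℓ s * (t - s) + K * (t - s) ^ 2 := by
  have h1 := hℓ.tangent_le t s
  have h2 := hK.dist_le_mul t ht s hs
  rw [Real.dist_eq, Real.dist_eq] at h2
  have h3 : (deriv ℓ t - deriv ℓ s) * (t - s) ≤ K * (t - s) ^ 2 := by
    calc (deriv ℓ t - deriv ℓ s) * (t - s) ≤ |(deriv ℓ t - deriv ℓ s) * (t - s)| := le_abs_self _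
      _ = |deriv ℓ t - deriv ℓ s| * |t - s| := abs_mul _ _
      _ ≤ K * |t - s| * |t - s| := by gcongr
      _ = K * (t - s) ^ 2 := by rw [mul_assoc, ← sq, sq_abs]
  linarith

variable {E ι : Type*} [NormedAddCommGroup E] [InnerProductSpace ℝ E] [Fintype ι]

/-- The total loss of the linear predictor `θ` on the signed features `ψ`. -/
noncomputable def marginRisk (ℓ : ℝ → ℝ) (ψ : ι → E) (θ : E) : ℝ := ∑ i, ℓ (inner ℝ (ψ i) θ)

/-- The gradient of `marginRisk`. -/
noncomputable def marginGrad (ℓ : ℝ → ℝ) (ψ : ι → E) (θ : E) : E := ∑ i, deriv ℓ (inner ℝ (ψ i) θ) • ψ i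

theorem inner_marginGrad (ψ : ι → E) (θ v : E) :
    inner ℝ (marginGrad ℓ ψ θ) v = ∑ i, deriv ℓ (inner ℝ (ψ i) θ) * inner ℝ (ψ i) v := by
  simp [marginGrad, sum_inner, real_inner_smul_left]

theorem IsSurrogateLoss.le_marginRisk (hℓ : IsSurrogateLoss ℓ) (ψ : ι → E) (θ : E) (i : ι) :
    ℓ (inner ℝ (ψ i) θ) ≤ marginRisk ℓ ψ θ :=
  Finset.single_le_sum (f := fun i => ℓ (inner ℝ (ψ i) θ)) (fun _ _ => hℓ.nonneg _)
    (Finset.mem_univ i)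

theorem IsSurrogateLoss.marginRisk_sub_le (hℓ : IsSurrogateLoss ℓ) (ψ : ι → E) (θ u : E) :
    marginRisk ℓ ψ θ - marginRisk ℓ ψ u ≤ inner ℝ (marginGrad ℓ ψ θ) (θ - u) := by
  rw [inner_marginGrad, marginRisk, marginRisk, ← Finset.sum_sub_distrib]
  refine Finset.sum_le_sum fun i _ => ?_
  have := hℓ.tangent_le (inner ℝ (ψ i) θ) (inner ℝ (ψ i) u)
  rw [inner_sub_right]
  linarith

theorem IsSurrogateLoss.exists_descent (hℓ : IsSurrogateLoss ℓ) (ψ : ι → E) (B : ℝ) :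
    ∃ η₀ : ℝ, 0 < η₀ ∧ ∀ η, 0 < η → η < η₀ → ∀ θ, marginRisk ℓ ψ θ ≤ B →
      marginRisk ℓ ψ (θ - η • marginGrad ℓ ψ θ)
        ≤ marginRisk ℓ ψ θ - η / 2 * ‖marginGrad ℓ ψ θ‖ ^ 2 := by
  obtain ⟨M, hM⟩ := hℓ.exists_lower_bound B
  obtain ⟨K, hK⟩ := hℓ.lipschitz_deriv (M - 1)
  set R : ℝ := ∑ i, ‖ψ i‖ with hR
  set Q : ℝ := ∑ i, ‖ψ i‖ ^ 2 with hQ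
  set D : ℝ := -deriv ℓ M with hD
  have hR0 : 0 ≤ R := Finset.sum_nonneg fun i _ => norm_nonneg _
  have hQ0 : 0 ≤ Q := Finset.sum_nonneg fun i _ => by positivity
  have hD0 : 0 ≤ D := neg_nonneg.2 (hℓ.deriv_nonpos M)
  have hmono : Monotone (deriv ℓ) := fun s t hst =>
    hℓ.convex.monotoneOn_deriv (fun x _ => hℓ.differentiable x) (Set.mem_univ s)
      (Set.mem_univ t) hst
  -- The first term keeps every margin from dropping by more than `1`, so the step stays where `K`
  -- is valid; the second makes the quadratic error at most half of the linear gain.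
  refine ⟨1 / (R * (D * R) + 2 * K * Q + 1), by positivity, fun η hη hη₀ θ hθ => ?_⟩
  rw [lt_div_iff₀ (by positivity)] at hη₀
  have hmargin : ∀ i, M ≤ inner ℝ (ψ i) θ := fun i => hM _ ((hℓ.le_marginRisk ψ θ i).trans hθ)
  set g := marginGrad ℓ ψ θ with hg
  have hgn : ‖g‖ ≤ D * R := by
    rw [hg, marginGrad, hR, Finset.mul_sum]
    refine norm_sum_le_of_le _ fun i _ => ?_
    rw [norm_smul, Real.norm_eq_abs, abs_of_nonpos (hℓ.deriv_nonpos _)]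
    gcongr
    exact neg_le_neg (hmono (hmargin i))
  have hstep : ∀ i, inner ℝ (ψ i) (θ - η • g) = inner ℝ (ψ i) θ - η * inner ℝ (ψ i) g := fun i => by
    rw [inner_sub_right, real_inner_smul_right]
  have hpsi : ∀ i, ‖ψ i‖ ≤ R := fun i =>
    Finset.single_le_sum (f := fun i => ‖ψ i‖) (fun _ _ => norm_nonneg _) (Finset.mem_univ i)
  have hnew : ∀ i, M - 1 ≤ inner ℝ (ψ i) (θ - η • g) := fun i => by
    rw [hstep]
    have h1 : inner ℝ (ψ i) g ≤ R * (D * R) :=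
      (real_inner_le_norm _ _).trans (mul_le_mul (hpsi i) hgn (norm_nonneg _) hR0)
    have h2 : η * inner ℝ (ψ i) g ≤ η * (R * (D * R)) := by gcongr
    have h3 : 0 ≤ η * (2 * K * Q) := by positivity
    linarith [hmargin i]
  have hsum : marginRisk ℓ ψ (θ - η • g)
      ≤ marginRisk ℓ ψ θ - η * ‖g‖ ^ 2 + K * η ^ 2 * (Q * ‖g‖ ^ 2) := by
    have hself : ‖g‖ ^ 2 = ∑ i, deriv ℓ (inner ℝ (ψ i) θ) * inner ℝ (ψ i) g := by
      rw [← inner_marginGrad, ← hg, real_inner_self_eq_norm_sq]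
    calc marginRisk ℓ ψ (θ - η • g)
        ≤ ∑ i, (ℓ (inner ℝ (ψ i) θ) - η * (deriv ℓ (inner ℝ (ψ i) θ) * inner ℝ (ψ i) g)
            + K * η ^ 2 * (‖ψ i‖ ^ 2 * ‖g‖ ^ 2)) := by
          refine Finset.sum_le_sum fun i _ => ?_
          have h := hℓ.le_quadratic hK ((by linarith : M - 1 ≤ M).trans (hmargin i)) (hnew i)
          have h2 : inner ℝ (ψ i) g ^ 2 ≤ ‖ψ i‖ ^ 2 * ‖g‖ ^ 2 := by
            rw [← mul_pow, ← sq_abs]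
            gcongr
            exact abs_real_inner_le_norm _ _
          have h3 : (K : ℝ) * η ^ 2 * inner ℝ (ψ i) g ^ 2 ≤ K * η ^ 2 * (‖ψ i‖ ^ 2 * ‖g‖ ^ 2) := by
            gcongr
          have h4 : inner ℝ (ψ i) (θ - η • g) - inner ℝ (ψ i) θ = -(η * inner ℝ (ψ i) g) := by
            rw [hstep]; ring
          rw [h4] at h
          refine h.trans (le_trans (le_of_eq ?_) (add_le_add_right h3 _))
          ring
      _ = _ := by
          rw [Finset.sum_add_distrib, Finset.sum_sub_distrib, ← Finset.mul_sum, ← Finset.mul_sum,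
            ← Finset.sum_mul, ← hself, marginRisk]
  have hsmall : η * (K * Q) ≤ 1 / 2 := by
    have : 0 ≤ η * (R * (D * R)) := by positivity
    linarith
  have : η * ‖g‖ ^ 2 * (η * (K * Q)) ≤ η * ‖g‖ ^ 2 * (1 / 2) := by gcongr
  linarith

theorem IsSurrogateLoss.exists_marginRisk_lt (hℓ : IsSurrogateLoss ℓ) (ψ : ι → E)
    (hsep : ∃ u, ∀ i, 0 < inner ℝ (ψ i) u) {r : ℝ} (hr : 0 < r) : ∃ u, marginRisk ℓ ψ u < r := by
  obtain ⟨u, hu⟩ := hsep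
  have h : Tendsto (fun s : ℝ => marginRisk ℓ ψ (s • u)) atTop (𝓝 (∑ _i : ι, (0 : ℝ))) := by
    refine tendsto_finsetSum _ fun i _ => hℓ.tendsto_zero.comp ?_
    simp only [real_inner_smul_right]
    exact tendsto_id.atTop_mul_const (hu i)
  rw [Finset.sum_const_zero] at h
  obtain ⟨s, hs⟩ := (h.eventually (gt_mem_nhds hr)).exists
  exact ⟨_, hs⟩

/-- Gradient descent with a small constant step size drives the loss of linearly separable data
to zero. -/
theorem IsSurrogateLoss.exists_tendsto_zero (hℓ : IsSurrogateLoss ℓ) (ψ : ι → E)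
    (hsep : ∃ u, ∀ i, 0 < inner ℝ (ψ i) u) (θ₀ : E) :
    ∃ η₀ : ℝ, 0 < η₀ ∧ ∀ η, 0 < η → η < η₀ →
      Tendsto (fun T : ℕ => marginRisk ℓ ψ ((fun θ => θ - η • marginGrad ℓ ψ θ)^[T] θ₀))
        atTop (𝓝 0) := by
  obtain ⟨η₀, hη₀, hdesc⟩ := hℓ.exists_descent ψ (marginRisk ℓ ψ θ₀)
  refine ⟨η₀, hη₀, fun η hη hlt => ?_⟩
  set θ : ℕ → E := fun T => (fun θ => θ - η • marginGrad ℓ ψ θ)^[T] θ₀ with hθ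
  have hsucc : ∀ T, θ (T + 1) = θ T - η • marginGrad ℓ ψ (θ T) := fun T =>
    Function.iterate_succ_apply' _ _ _
  have hbound : ∀ T, marginRisk ℓ ψ (θ T) ≤ marginRisk ℓ ψ θ₀ := by
    intro T
    induction T with
    | zero => exact le_rfl
    | succ T ih =>
      rw [hsucc]
      refine (hdesc η hη hlt _ ih).trans ?_
      have : 0 ≤ η / 2 * ‖marginGrad ℓ ψ (θ T)‖ ^ 2 := by positivity
      linarith
  have hstep : ∀ T, marginRisk ℓ ψ (θ (T + 1))
      ≤ marginRisk ℓ ψ (θ T) - η / 2 * ‖marginGrad ℓ ψ (θ T)‖ ^ 2 := fun T => by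
    rw [hsucc]; exact hdesc η hη hlt _ (hbound T)
  have hanti : Antitone fun T => marginRisk ℓ ψ (θ T) := by
    refine antitone_nat_of_succ_le fun T => (hstep T).trans ?_
    have : 0 ≤ η / 2 * ‖marginGrad ℓ ψ (θ T)‖ ^ 2 := by positivity
    linarith
  -- Expand the square. Convexity bounds the cross term, and the descent inequality absorbs `η ^ 2 *
  -- ‖grad‖ ^ 2` by replacing the risk at `T` with the risk at `T + 1`.
  have hregret : ∀ u T, ‖θ (T + 1) - u‖ ^ 2
      ≤ ‖θ T - u‖ ^ 2 - 2 * η * (marginRisk ℓ ψ (θ (T + 1)) - marginRisk ℓ ψ u) := by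
    intro u T
    have h1 : ‖θ (T + 1) - u‖ ^ 2 = ‖θ T - u‖ ^ 2
        - 2 * η * inner ℝ (marginGrad ℓ ψ (θ T)) (θ T - u)
        + η ^ 2 * ‖marginGrad ℓ ψ (θ T)‖ ^ 2 := by
      rw [hsucc, sub_right_comm, norm_sub_sq_real, real_inner_smul_right, norm_smul,
        real_inner_comm, mul_pow, Real.norm_eq_abs, sq_abs]
      ring
    have h2 := mul_le_mul_of_nonneg_left (hℓ.marginRisk_sub_le ψ (θ T) u) hη.le
    have h3 := mul_le_mul_of_nonneg_left (hstep T) hη.le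
    rw [h1]
    linarith
  have htotal : ∀ u (T : ℕ), ‖θ T - u‖ ^ 2
      + 2 * η * (T * (marginRisk ℓ ψ (θ T) - marginRisk ℓ ψ u)) ≤ ‖θ 0 - u‖ ^ 2 := by
    intro u T
    induction T with
    | zero => simp
    | succ T ih =>
      have h1 := hregret u T
      have h2 : 2 * η * (T * marginRisk ℓ ψ (θ (T + 1))) ≤ 2 * η * (T * marginRisk ℓ ψ (θ T)) := by
        gcongr
        exact hanti (Nat.le_succ T)
      push_cast
      linarith
  rw [Metric.tendsto_atTop]
  intro r hr
  -- The infimum `0` need not be attained, so the comparison point is a large multiple of a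
  -- separator, chosen for each accuracy `r`.
  obtain ⟨u, hu⟩ := hℓ.exists_marginRisk_lt ψ hsep (half_pos hr)
  obtain ⟨N, hN⟩ := exists_nat_gt (‖θ 0 - u‖ ^ 2 / (η * r))
  have hN0 : (0 : ℝ) < N := lt_of_le_of_lt (by positivity) hN
  rw [div_lt_iff₀ (by positivity)] at hN
  refine ⟨N, fun T hT => ?_⟩
  have hnonneg : 0 ≤ marginRisk ℓ ψ (θ T) := Finset.sum_nonneg fun i _ => hℓ.nonneg _
  rw [Real.dist_eq, sub_zero, abs_of_nonneg hnonneg]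
  refine lt_of_le_of_lt (hanti hT) ?_
  have h1 := htotal u N
  by_contra! hcon
  have h2 : 2 * η * (N * (r / 2)) ≤ 2 * η * (N * (marginRisk ℓ ψ (θ N) - marginRisk ℓ ψ u)) := by
    have : r / 2 ≤ marginRisk ℓ ψ (θ N) - marginRisk ℓ ψ u := by
      change r ≤ marginRisk ℓ ψ (θ N) at hcon
      linarith
    gcongr
  have h3 : 0 ≤ ‖θ N - u‖ ^ 2 := by positivity
  linarith

end GradientDescent

/-! ### The network with one filter of width one -/

section Network

variable {d : ℕ}

/-- The squared norm of one of the two halves of `x`. -/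
def blockSq (x : EuclideanSpace ℝ (Fin (2 * d))) (i : Fin 2) : ℝ :=
  ∑ l : Fin d, x (finProdFinEquiv (i, l)) ^ 2

theorem blockSq_nonneg (x : EuclideanSpace ℝ (Fin (2 * d))) (i : Fin 2) : 0 ≤ blockSq x i :=
  Finset.sum_nonneg fun _ _ => sq_nonneg _

@[fun_prop]
theorem measurable_blockSq (i : Fin 2) :
    Measurable fun x : EuclideanSpace ℝ (Fin (2 * d)) => blockSq x i := by
  unfold blockSq
  fun_prop

theorem target_eq (x : EuclideanSpace ℝ (Fin (2 * d))) :
    target d x = sgn (blockSq x 0 - blockSq x 1) := by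
  simp only [target, blockSq, Finset.sum_filter]
  rw [← finProdFinEquiv.sum_comp, ← finProdFinEquiv.sum_comp, Fintype.sum_prod_type,
    Fintype.sum_prod_type]
  simp [Fin.sum_univ_two, not_le_of_gt]

theorem cnn_eq (W : Weights 1 2) (x : EuclideanSpace ℝ (Fin (2 * d))) :
    cnn squarePool W x
      = W.1 0 ^ 2 * (W.2.1 0 * blockSq x 0 + W.2.1 1 * blockSq x 1) + W.2.2 := by
  have hconv : ∀ i : Fin (2 * d), conv W.1 x i = W.1 0 * x i := fun i => by
    simp [conv, Nat.mod_eq_of_lt i.isLt]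
  simp only [cnn, squarePool, hconv, mul_pow, ← Finset.mul_sum, Fin.sum_univ_two, blockSq]
  ring

theorem sgn_mul_pos {t : ℝ} {y : ℤˣ} (h : 0 < ((y : ℤ) : ℝ) * t) : sgn t = y := by
  rcases Int.units_eq_one_or y with rfl | rfl
  · rw [sgn, if_pos]; simpa using h.le
  · rw [sgn, if_neg]; simpa using h

theorem target_mem_cnnClass : target d ∈ cnnClass 1 2 d squarePool := by
  refine ⟨(fun _ => 1, ![1, -1], 0), funext fun x => ?_⟩
  rw [target_eq, cnn_eq]
  simp [sub_eq_add_neg]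

/-- The features seen by the second layer. -/
def feature (w : Fin 1 → ℝ) (x : EuclideanSpace ℝ (Fin (2 * d))) : EuclideanSpace ℝ (Fin 3) :=
  !₂[w 0 ^ 2 * blockSq x 0, w 0 ^ 2 * blockSq x 1, 1]

/-- The weights of the second layer as a vector. -/
def secondLayer (W : Weights 1 2) : EuclideanSpace ℝ (Fin 3) := !₂[W.2.1 0, W.2.1 1, W.2.2]

theorem inner_feature_secondLayer (W : Weights 1 2) (x : EuclideanSpace ℝ (Fin (2 * d))) :
    inner ℝ (feature W.1 x) (secondLayer W) = cnn squarePool W x := by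
  rw [cnn_eq]
  simp [feature, secondLayer, PiLp.inner_apply, Fin.sum_univ_three]
  ring

/-- The features, multiplied by the labels. -/
def signedFeature {n : ℕ} (w : Fin 1 → ℝ) (S : Dataset (EuclideanSpace ℝ (Fin (2 * d))) n)
    (i : Fin n) : EuclideanSpace ℝ (Fin 3) := (((S i).2 : ℤ) : ℝ) • feature w (S i).1

theorem inner_signedFeature {n : ℕ} (W : Weights 1 2)
    (S : Dataset (EuclideanSpace ℝ (Fin (2 * d))) n) (i : Fin n) :
    inner ℝ (signedFeature W.1 S i) (secondLayer W)
      = (((S i).2 : ℤ) : ℝ) * cnn squarePool W (S i).1 := by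
  rw [signedFeature, real_inner_smul_left, inner_feature_secondLayer]

theorem trainLoss_eq {n : ℕ} (ℓ : ℝ → ℝ) (S : Dataset (EuclideanSpace ℝ (Fin (2 * d))) n)
    (W : Weights 1 2) :
    trainLoss ℓ squarePool S W = marginRisk ℓ (signedFeature W.1 S) (secondLayer W) := by
  simp only [trainLoss, marginRisk, inner_signedFeature]

/-- The path `V` is left abstract so that the same chain rule serves `a 0`, `a 1` and `b`. -/
theorem hasDerivAt_trainLoss {n : ℕ} {ℓ : ℝ → ℝ} (hℓ : Differentiable ℝ ℓ)
    (S : Dataset (EuclideanSpace ℝ (Fin (2 * d))) n) (V : ℝ → Weights 1 2) (W : Weights 1 2)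
    (j : Fin 3) {t₀ : ℝ} (hV : V t₀ = W)
    (hcnn : ∀ i t, cnn squarePool (V t) (S i).1
      = cnn squarePool W (S i).1 + (t - t₀) * feature W.1 (S i).1 j) :
    HasDerivAt (fun t => trainLoss ℓ squarePool S (V t))
      (marginGrad ℓ (signedFeature W.1 S) (secondLayer W) j) t₀ := by
  have hgrad : marginGrad ℓ (signedFeature W.1 S) (secondLayer W) j
      = ∑ i, deriv ℓ ((((S i).2 : ℤ) : ℝ) * cnn squarePool W (S i).1)
          * ((((S i).2 : ℤ) : ℝ) * feature W.1 (S i).1 j) := by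
    simp only [marginGrad, inner_signedFeature]
    simp [signedFeature]
  rw [hgrad]
  refine HasDerivAt.fun_sum fun i _ => ?_
  have h1 : HasDerivAt (fun t => (((S i).2 : ℤ) : ℝ) * cnn squarePool (V t) (S i).1)
      ((((S i).2 : ℤ) : ℝ) * feature W.1 (S i).1 j) t₀ := by
    simp only [hcnn]
    refine HasDerivAt.const_mul _ (HasDerivAt.const_add _ ?_)
    simpa using ((hasDerivAt_id t₀).sub_const t₀).mul_const (feature W.1 (S i).1 j)
  refine HasDerivAt.comp t₀ ?_ h1
  rw [hV]
  exact (hℓ _).hasDerivAt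

theorem secondLayer_gdStep {n : ℕ} {ℓ : ℝ → ℝ} (hℓ : Differentiable ℝ ℓ)
    (S : Dataset (EuclideanSpace ℝ (Fin (2 * d))) n) (η : ℝ) (W : Weights 1 2) :
    secondLayer (gdStep ℓ squarePool S η W)
      = secondLayer W - η • marginGrad ℓ (signedFeature W.1 S) (secondLayer W) := by
  have h0 := hasDerivAt_trainLoss hℓ S (fun t => (W.1, Function.update W.2.1 0 t, W.2.2)) W 0
    (t₀ := W.2.1 0) (by simp) (fun i t => by simp [cnn_eq, feature]; ring)
  have h1 := hasDerivAt_trainLoss hℓ S (fun t => (W.1, Function.update W.2.1 1 t, W.2.2)) W 1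
    (t₀ := W.2.1 1) (by simp) (fun i t => by simp [cnn_eq, feature]; ring)
  have h2 := hasDerivAt_trainLoss hℓ S (fun t => (W.1, W.2.1, t)) W 2
    (t₀ := W.2.2) rfl (fun i t => by simp [cnn_eq, feature])
  ext j
  fin_cases j
  · simpa [secondLayer, gdStep] using Or.inl h0.deriv
  · simpa [secondLayer, gdStep] using Or.inl h1.deriv
  · simpa [secondLayer, gdStep] using Or.inl h2.deriv

theorem iterate_gdStep {n : ℕ} {ℓ : ℝ → ℝ} (hℓ : Differentiable ℝ ℓ)
    (S : Dataset (EuclideanSpace ℝ (Fin (2 * d))) n) (η : ℝ) (W : Weights 1 2) (T : ℕ) :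
    ((gdStep ℓ squarePool S η)^[T] W).1 = W.1 ∧
      secondLayer ((gdStep ℓ squarePool S η)^[T] W)
        = (fun θ => θ - η • marginGrad ℓ (signedFeature W.1 S) θ)^[T] (secondLayer W) := by
  induction T with
  | zero => exact ⟨rfl, rfl⟩
  | succ T ih =>
    rw [Function.iterate_succ_apply', Function.iterate_succ_apply']
    refine ⟨ih.1, ?_⟩
    rw [secondLayer_gdStep hℓ, ih.1, ih.2]

theorem signedFeature_separable {n : ℕ} {w : Fin 1 → ℝ} (hw : w 0 ≠ 0)
    (S : Dataset (EuclideanSpace ℝ (Fin (2 * d))) n) (hS : ∀ i, (S i).2 = target d (S i).1) :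
    ∃ u, ∀ i, 0 < inner ℝ (signedFeature w S i) u := by
  have hw2 : 0 < w 0 ^ 2 := by positivity
  set m : Fin n → ℝ := fun i => w 0 ^ 2 * (blockSq (S i).1 0 - blockSq (S i).1 1) with hm
  -- The target labels `0` as `1`, so its own margins may vanish. A positive bias below the finitely
  -- many gaps on the negative side makes all margins strict.
  obtain ⟨b, hb, hbm⟩ : ∃ b : ℝ, 0 < b ∧ ∀ i, m i < 0 → b < -m i := by
    have : ∀ᶠ b in 𝓝[>] (0 : ℝ), 0 < b ∧ ∀ i, m i < 0 → b < -m i := by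
      refine (eventually_mem_nhdsWithin).and (eventually_all.2 fun i => ?_)
      by_cases hi : m i < 0
      · filter_upwards [nhdsWithin_le_nhds (gt_mem_nhds (neg_pos.2 hi))] with b hb _ using hb
      · exact Eventually.of_forall fun b h => absurd h hi
    exact this.exists
  refine ⟨secondLayer (w, ![1, -1], b), fun i => ?_⟩
  have h := inner_signedFeature (w, ![1, -1], b) S i
  refine lt_of_lt_of_eq ?_ h.symm
  have hc : cnn squarePool (w, ![1, -1], b) (S i).1 = m i + b := by
    simp only [cnn_eq, hm, Matrix.cons_val_zero, Matrix.cons_val_one]; ring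
  rw [hc, hS, target_eq, sgn]
  split_ifs with h0
  · have : 0 ≤ m i := mul_nonneg hw2.le h0
    simp; linarith
  · have : m i < 0 := mul_neg_of_pos_of_neg hw2 (not_le.1 h0)
    have := hbm i this
    simp; linarith

theorem gradientDescent_finds_erm (ℓ : ℝ → ℝ) (hℓ : IsSurrogateLoss ℓ) (W₀ : Weights 1 2)
    (hW₀ : W₀.1 0 ≠ 0) {n : ℕ} (S : Dataset (EuclideanSpace ℝ (Fin (2 * d))) n)
    (hS : ∀ i, (S i).2 = target d (S i).1) :
    ∃ η₀ : ℝ, 0 < η₀ ∧ ∀ η : ℝ, 0 < η → η < η₀ →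
      Tendsto (fun T : ℕ => trainLoss ℓ squarePool S ((gdStep ℓ squarePool S η)^[T] W₀))
        atTop (𝓝 0) ∧
      ∀ᶠ T : ℕ in atTop,
        (∀ i, sgn (cnn squarePool ((gdStep ℓ squarePool S η)^[T] W₀) (S i).1) = (S i).2) ∧
        IsEmpiricalRiskMinimizer (cnnClass 1 2 d squarePool) S
          (fun x => sgn (cnn squarePool ((gdStep ℓ squarePool S η)^[T] W₀) x)) := by
  obtain ⟨η₀, hη₀, h⟩ := hℓ.exists_tendsto_zero _ (signedFeature_separable hW₀ S hS)
    (secondLayer W₀)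
  refine ⟨η₀, hη₀, fun η hη hlt => ?_⟩
  have hlim : Tendsto (fun T : ℕ => trainLoss ℓ squarePool S ((gdStep ℓ squarePool S η)^[T] W₀))
      atTop (𝓝 0) := by
    refine (h η hη hlt).congr fun T => ?_
    rw [trainLoss_eq, (iterate_gdStep hℓ.differentiable S η W₀ T).1,
      (iterate_gdStep hℓ.differentiable S η W₀ T).2]
  refine ⟨hlim, ?_⟩
  filter_upwards [hlim.eventually (gt_mem_nhds one_pos)] with T hT
  have hfit : ∀ i, sgn (cnn squarePool ((gdStep ℓ squarePool S η)^[T] W₀) (S i).1) = (S i).2 := by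
    intro i
    refine sgn_mul_pos ?_
    by_contra! hneg
    have h1 := hℓ.le_marginRisk (signedFeature ((gdStep ℓ squarePool S η)^[T] W₀).1 S)
      (secondLayer ((gdStep ℓ squarePool S η)^[T] W₀)) i
    rw [← trainLoss_eq, inner_signedFeature] at h1
    linarith [hℓ.antitone hneg, hℓ.one_le]
  refine ⟨hfit, ⟨_, rfl⟩, fun h' _ => ?_⟩
  have : empiricalErrors S
      (fun x => sgn (cnn squarePool ((gdStep ℓ squarePool S η)^[T] W₀) x)) = 0 := by
    simp [empiricalErrors, hfit]
  rw [this]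
  exact Nat.zero_le _

theorem ae_gaussianInit_ne_zero : ∀ᵐ W₀ ∂(gaussianInit 1 2), W₀.1 0 ≠ 0 := by
  have := nullSingletonClass_gaussianReal (μ := 0) (v := 1) one_ne_zero
  have h1 : ∀ᵐ t ∂(gaussianReal 0 1), t ≠ 0 := by simp [ae_iff]
  have h2 : ∀ᵐ w ∂(Measure.pi fun _ : Fin 1 => gaussianReal 0 1), w 0 ≠ 0 :=
    (measurePreserving_eval (fun _ : Fin 1 => gaussianReal 0 1) 0).quasiMeasurePreserving.ae h1
  exact Measure.quasiMeasurePreserving_fst.ae h2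

end Network

/-! ### Uniform convergence for consistent hypotheses -/

section UniformConvergence

open Classical in
/-- The weight of a pair of a training point and a ghost point, each marked by whether it is an
error: training errors are excluded and ghost errors count twice. -/
noncomputable def errorWeight (q : Prop × Prop) : ℝ≥0∞ :=
  (if q.1 then 0 else 1) * (if q.2 then 2 else 1)

theorem errorWeight_add_swap_le (q : Prop × Prop) :
    errorWeight q + errorWeight q.swap ≤ 2 := by
  obtain ⟨a, b⟩ := q
  by_cases ha : a <;> by_cases hb : b <;> simp [errorWeight, ha, hb, one_add_one_eq_two]

/-- Swap the pairs at the positions that are marked. -/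
def swapAt {ι α : Type*} (s : ι → Bool) (z : ι → α × α) (i : ι) : α × α :=
  bif s i then (z i).swap else z i

/-- The sum over swap patterns factors into one two-term sum per position, each at most `2`. A fixed
trace therefore has average weight at most `1`. -/
theorem sum_prod_errorWeight_swapAt_le {n : ℕ} (τ : Fin n → Prop × Prop) :
    ∑ s : Fin n → Bool, ∏ i, errorWeight (swapAt s τ i) ≤ 2 ^ n := by
  have h := Finset.prod_univ_sum (fun _ : Fin n => (Finset.univ : Finset Bool))
    (fun i b => errorWeight (bif b then (τ i).swap else τ i))
  rw [Fintype.piFinset_univ] at h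
  simp only [swapAt]
  rw [← h]
  calc _ ≤ ∏ _i : Fin n, (2 : ℝ≥0∞) := by
        refine Finset.prod_le_prod' fun i _ => ?_
        rw [Fintype.sum_bool, add_comm]
        exact errorWeight_add_swap_le (τ i)
    _ = 2 ^ n := by simp

variable {Z κ : Type*}

/-- Which points of each pair lie in `D`. -/
def pairTrace {n : ℕ} (D : Set Z) (z : Fin n → Z × Z) (i : Fin n) : Prop × Prop :=
  ((z i).1 ∈ D, (z i).2 ∈ D)

theorem pairTrace_swapAt {n : ℕ} (D : Set Z) (s : Fin n → Bool) (z : Fin n → Z × Z) :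
    pairTrace D (swapAt s z) = swapAt s (pairTrace D z) := by
  funext i
  cases h : s i <;> simp [pairTrace, swapAt, h]

variable [MeasurableSpace Z]

theorem measurable_errorWeight_pairTrace {n : ℕ} {D : Set Z} (hD : MeasurableSet D) :
    Measurable fun z : Fin n → Z × Z => ∏ i, errorWeight (pairTrace D z i) := by
  classical
  refine Finset.measurable_prod _ fun i _ => ?_
  refine Measurable.mul ?_ ?_
  · exact Measurable.ite (hD.preimage (by fun_prop)) measurable_const measurable_const
  · exact Measurable.ite (hD.preimage (by fun_prop)) measurable_const measurable_const

theorem lintegral_pi_prod {n : ℕ} (P : Measure Z) [IsProbabilityMeasure P] {f : Z → ℝ≥0∞}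
    (hf : Measurable f) :
    ∫⁻ S, ∏ i, f (S i) ∂(Measure.pi fun _ : Fin n => P) = (∫⁻ x, f x ∂P) ^ n := by
  rw [lintegral_prod_eq_prod_lintegral_of_indepFun Finset.univ
    (fun i (S : Fin n → Z) => f (S i)) (iIndepFun_pi fun _ => hf.aemeasurable)
    (fun i => hf.comp (measurable_pi_apply i))]
  have : ∀ i : Fin n, ∫⁻ S, f (S i) ∂(Measure.pi fun _ : Fin n => P) = ∫⁻ x, f x ∂P := fun i =>
    (measurePreserving_eval (fun _ : Fin n => P) i).lintegral_comp hf
  simp [this]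

variable [Countable κ]

theorem lintegral_iSup_errorWeight_le (P : Measure Z) [IsProbabilityMeasure P] {D : κ → Set Z}
    (hD : ∀ k, MeasurableSet (D k)) {n Γ : ℕ}
    (hΓ : ∀ z : Fin n → Z × Z, (Set.range fun k => pairTrace (D k) z).ncard ≤ Γ) :
    ∫⁻ z, ⨆ k, ∏ i, errorWeight (pairTrace (D k) z i) ∂(Measure.pi fun _ : Fin n => P.prod P)
      ≤ Γ := by
  set μ := Measure.pi fun _ : Fin n => P.prod P with hμ
  set G : (Fin n → Z × Z) → ℝ≥0∞ := fun z => ⨆ k, ∏ i, errorWeight (pairTrace (D k) z i) with hG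
  have hGm : Measurable G := Measurable.iSup fun k => measurable_errorWeight_pairTrace (hD k)
  have hswap : ∀ s : Fin n → Bool, MeasurePreserving (swapAt s) μ μ := by
    intro s
    refine measurePreserving_pi (fun _ => P.prod P) (fun _ => P.prod P)
      (f := fun i p => bif s i then p.swap else p) fun i => ?_
    cases s i
    · exact MeasurePreserving.id _
    · exact Measure.measurePreserving_swap
  -- Swapping acts on traces, so the same at most `Γ` traces serve all `s`; the supremum is bounded
  -- by the sum over them.
  have hpoint : ∀ z, ∑ s : Fin n → Bool, G (swapAt s z) ≤ 2 ^ n * Γ := by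
    intro z
    have hfin : (Set.range fun k => pairTrace (D k) z).Finite := Set.toFinite _
    calc ∑ s : Fin n → Bool, G (swapAt s z)
        ≤ ∑ s : Fin n → Bool, ∑ τ ∈ hfin.toFinset, ∏ i, errorWeight (swapAt s τ i) := by
          refine Finset.sum_le_sum fun s _ => iSup_le fun k => ?_
          rw [pairTrace_swapAt]
          exact Finset.single_le_sum
            (f := fun τ : Fin n → Prop × Prop => ∏ i, errorWeight (swapAt s τ i))
            (fun _ _ => zero_le) (hfin.mem_toFinset.2 ⟨k, rfl⟩)
      _ = ∑ τ ∈ hfin.toFinset, ∑ s : Fin n → Bool, ∏ i, errorWeight (swapAt s τ i) :=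
          Finset.sum_comm
      _ ≤ ∑ _τ ∈ hfin.toFinset, 2 ^ n :=
          Finset.sum_le_sum fun τ _ => sum_prod_errorWeight_swapAt_le τ
      _ = 2 ^ n * (hfin.toFinset.card : ℝ≥0∞) := by rw [Finset.sum_const, nsmul_eq_mul, mul_comm]
      _ ≤ 2 ^ n * Γ := by
          rw [← Set.ncard_eq_toFinset_card _ hfin]
          gcongr
          exact_mod_cast hΓ z
  have htotal : 2 ^ n * ∫⁻ z, G z ∂μ ≤ 2 ^ n * Γ := by
    calc 2 ^ n * ∫⁻ z, G z ∂μ = ∑ s : Fin n → Bool, ∫⁻ z, G (swapAt s z) ∂μ := by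
          simp [(hswap _).lintegral_comp hGm]
      _ = ∫⁻ z, ∑ s : Fin n → Bool, G (swapAt s z) ∂μ :=
          (lintegral_finsetSum _ fun s _ => hGm.comp (hswap s).measurable).symm
      _ ≤ ∫⁻ _z, 2 ^ n * Γ ∂μ := lintegral_mono hpoint
      _ = 2 ^ n * Γ := by simp
  exact (ENNReal.mul_le_mul_iff_right (by simp) (by simp)).1 htotal

/-- If a countable family of error sets has at most `Γ` traces on `n` pairs of points, then the
probability that some member of measure more than `r` is missed by `n` samples is at most
`Γ / (1 + r) ^ n`. -/
theorem measure_exists_consistent_mul_le (P : Measure Z) [IsProbabilityMeasure P] {D : κ → Set Z}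
    (hD : ∀ k, MeasurableSet (D k)) {n Γ : ℕ}
    (hΓ : ∀ z : Fin n → Z × Z, (Set.range fun k => pairTrace (D k) z).ncard ≤ Γ) (r : ℝ≥0∞) :
    Measure.pi (fun _ : Fin n => P) {S | ∃ k, (∀ i, S i ∉ D k) ∧ r < P (D k)} * (1 + r) ^ n
      ≤ Γ := by
  classical
  set B : Set (Fin n → Z) := {S | ∃ k, (∀ i, S i ∉ D k) ∧ r < P (D k)} with hB
  have hBm : MeasurableSet B := by
    simp only [hB, Set.ofPred_exists]
    refine MeasurableSet.iUnion fun k => ?_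
    refine MeasurableSet.inter (s₁ := {S : Fin n → Z | ∀ i, S i ∉ D k}) ?_ (MeasurableSet.const _)
    rw [Set.ofPred_forall]
    exact MeasurableSet.iInter fun i => (hD k).compl.preimage (measurable_pi_apply i)
  set G : (Fin n → Z × Z) → ℝ≥0∞ := fun z => ⨆ k, ∏ i, errorWeight (pairTrace (D k) z i) with hG
  have hGm : Measurable G := Measurable.iSup fun k => measurable_errorWeight_pairTrace (hD k)
  have hpair : Measurable fun q : (Fin n → Z) × (Fin n → Z) => fun i => (q.1 i, q.2 i) := by
    fun_prop
  -- Counting ghost errors twice gives each coordinate the mean `1 + P (D k)`; this is where the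
  -- exponential gain arises.
  have hghost : ∀ k, ∫⁻ S', ∏ i, (if S' i ∈ D k then 2 else 1 : ℝ≥0∞)
      ∂(Measure.pi fun _ : Fin n => P) = (1 + P (D k)) ^ n := by
    intro k
    rw [lintegral_pi_prod P (f := fun x => if x ∈ D k then 2 else 1)
      (Measurable.ite (hD k) measurable_const measurable_const)]
    congr 1
    have : ∀ x, (if x ∈ D k then 2 else 1 : ℝ≥0∞) = 1 + (D k).indicator 1 x := fun x => by
      by_cases hx : x ∈ D k <;> simp [hx, one_add_one_eq_two]
    simp only [this]
    rw [lintegral_add_left measurable_const, lintegral_indicator_one (hD k)]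
    simp
  have hlower : ∀ S, B.indicator (fun _ => (1 + r) ^ n) S
      ≤ ∫⁻ S', G (fun i => (S i, S' i)) ∂(Measure.pi fun _ : Fin n => P) := by
    intro S
    by_cases hS : S ∈ B
    · rw [Set.indicator_of_mem hS]
      obtain ⟨k, hk, hr⟩ := hS
      calc (1 + r) ^ n ≤ (1 + P (D k)) ^ n := by gcongr
        _ = ∫⁻ S', ∏ i, (if S' i ∈ D k then 2 else 1 : ℝ≥0∞)
              ∂(Measure.pi fun _ : Fin n => P) := (hghost k).symm
        _ ≤ _ := by
            refine lintegral_mono fun S' => ?_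
            refine le_trans (le_of_eq ?_)
              (le_iSup (fun k => ∏ i, errorWeight (pairTrace (D k) (fun i => (S i, S' i)) i)) k)
            refine Finset.prod_congr rfl fun i _ => ?_
            simp [errorWeight, pairTrace, hk i]
    · rw [Set.indicator_of_notMem hS]
      exact zero_le
  calc Measure.pi (fun _ : Fin n => P) B * (1 + r) ^ n
      = ∫⁻ S, B.indicator (fun _ => (1 + r) ^ n) S ∂(Measure.pi fun _ : Fin n => P) := by
        rw [lintegral_indicator_const hBm, mul_comm]
    _ ≤ ∫⁻ S, ∫⁻ S', G (fun i => (S i, S' i)) ∂(Measure.pi fun _ : Fin n => P)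
          ∂(Measure.pi fun _ : Fin n => P) := lintegral_mono hlower
    _ = ∫⁻ q, G (fun i => (q.1 i, q.2 i))
          ∂((Measure.pi fun _ : Fin n => P).prod (Measure.pi fun _ : Fin n => P)) :=
        (lintegral_prod _ (hGm.comp hpair).aemeasurable).symm
    _ = ∫⁻ z, G z ∂(Measure.pi fun _ : Fin n => P.prod P) :=
        ((measurePreserving_arrowProdEquivProdArrow Z Z (Fin n) (fun _ => P)
          (fun _ => P)).lintegral_comp (hGm.comp hpair)).symm
    _ ≤ Γ := lintegral_iSup_errorWeight_le P hD hΓ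

end UniformConvergence

/-! ### Growth of the class of half-spaces -/

section HalfSpaces

/-- More than `m` vectors are linearly dependent. A half-space matching the sign pattern of a
dependence makes every term `g i * θ ⬝ᵥ v i` nonnegative, yet they sum to zero. Boundary points
count as positive, so a negative coefficient is needed to make one term strict. -/
theorem card_le_of_shatters_halfSpaces {α : Type*} [Fintype α] [DecidableEq α] {m : ℕ}
    (v : α → Fin m → ℝ) {𝒜 : Finset (Finset α)}
    (h𝒜 : ∀ u ∈ 𝒜, ∃ θ : Fin m → ℝ, ∀ i, i ∈ u ↔ 0 ≤ θ ⬝ᵥ v i) {s : Finset α}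
    (hs : 𝒜.Shatters s) : s.card ≤ m := by
  by_contra! hcard
  have hdep : ¬ LinearIndependent ℝ fun i : s => v i := fun hli => by
    have := hli.fintype_card_le_finrank
    simp at this
    omega
  obtain ⟨g, hg, i₀, hi₀⟩ : ∃ g : s → ℝ, ∑ i, g i • v i = 0 ∧ ∃ i, g i < 0 := by
    obtain ⟨g, hg, i, hi⟩ := Fintype.not_linearIndependent_iff.1 hdep
    rcases lt_or_gt_of_ne hi with h | h
    · exact ⟨g, hg, i, h⟩
    · exact ⟨-g, by simpa [Finset.sum_neg_distrib] using hg, i, by simpa using h⟩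
  obtain ⟨u, hu, hsu⟩ := @hs ((Finset.univ.filter fun i : s => 0 ≤ g i).map
    (Function.Embedding.subtype _)) (by
      intro i hi
      simp only [Finset.mem_map, Function.Embedding.coe_subtype] at hi
      obtain ⟨j, -, rfl⟩ := hi
      exact j.2)
  obtain ⟨θ, hθ⟩ := h𝒜 u hu
  have hsign : ∀ i : s, 0 ≤ θ ⬝ᵥ v i ↔ 0 ≤ g i := by
    intro i
    have := congrArg (fun t => (i : α) ∈ t) hsu
    simpa [hθ] using this
  have hzero : ∑ i, g i * θ ⬝ᵥ v i = 0 := by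
    have := congrArg (fun x => θ ⬝ᵥ x) hg
    simpa [dotProduct_sum, dotProduct_smul] using this
  have hpos : 0 < ∑ i, g i * θ ⬝ᵥ v i := by
    refine Finset.sum_pos' (fun i _ => ?_) ⟨i₀, Finset.mem_univ _, ?_⟩
    · by_cases hi : 0 ≤ g i
      · exact mul_nonneg hi ((hsign i).2 hi)
      · exact mul_nonneg_of_nonpos_of_nonpos (not_le.1 hi).le
          (not_le.1 (mt (hsign i).1 hi)).le
    · exact mul_pos_of_neg_of_neg hi₀ (not_le.1 (mt (hsign i₀).1 (not_le.2 hi₀)))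
  exact hpos.ne' hzero

theorem card_halfSpaces_le {α : Type*} [Fintype α] [DecidableEq α] (v : α → Fin 3 → ℝ)
    {𝒜 : Finset (Finset α)} (h𝒜 : ∀ u ∈ 𝒜, ∃ θ : Fin 3 → ℝ, ∀ i, i ∈ u ↔ 0 ≤ θ ⬝ᵥ v i) :
    𝒜.card ≤ (Fintype.card α + 1) ^ 3 := by
  have hdim : 𝒜.vcDim ≤ 3 := Finset.sup_le fun s hs =>
    card_le_of_shatters_halfSpaces v h𝒜 (Finset.mem_shatterer.1 hs)
  calc 𝒜.card ≤ ∑ k ∈ Finset.Iic 𝒜.vcDim, (Fintype.card α).choose k :=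
        𝒜.card_le_card_shatterer.trans Finset.card_shatterer_le_sum_vcDim
    _ ≤ ∑ k ∈ Finset.Iic 3, (Fintype.card α).choose k :=
        Finset.sum_le_sum_of_subset (Finset.Iic_subset_Iic.2 hdim)
    _ ≤ ∑ k ∈ Finset.Iic 3, Fintype.card α ^ k :=
        Finset.sum_le_sum fun k _ => Nat.choose_le_pow _ _
    _ ≤ (Fintype.card α + 1) ^ 3 := by
        rw [show Finset.Iic 3 = {0, 1, 2, 3} from rfl]
        simp
        nlinarith [Nat.zero_le (Fintype.card α)]

/-- The labelled points that the half-space with normal vector `θ` (in the features `v`) gets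
wrong. -/
def halfSpaceErrors {X : Type*} (v : X → Fin 3 → ℝ) (θ : Fin 3 → ℝ) : Set (X × ℤˣ) :=
  {z | sgn (θ ⬝ᵥ v z.1) ≠ z.2}

theorem ncard_range_pairTrace_le {X κ : Type*} (v : X → Fin 3 → ℝ) (θ : κ → Fin 3 → ℝ) {n : ℕ}
    (z : Fin n → (X × ℤˣ) × (X × ℤˣ)) :
    (Set.range fun k => pairTrace (halfSpaceErrors v (θ k)) z).ncard ≤ (2 * n + 1) ^ 3 := by
  classical
  set w : Fin n × Bool → Fin 3 → ℝ := fun i => v (bif i.2 then (z i.1).2.1 else (z i.1).1.1)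
  set 𝒜 : Finset (Finset (Fin n × Bool)) :=
    {u | ∃ θ : Fin 3 → ℝ, ∀ i, i ∈ u ↔ 0 ≤ θ ⬝ᵥ w i} with h𝒜
  set φ : Finset (Fin n × Bool) → Fin n → Prop × Prop := fun u i =>
    ((if (i, false) ∈ u then (1 : ℤˣ) else -1) ≠ (z i).1.2,
      (if (i, true) ∈ u then (1 : ℤˣ) else -1) ≠ (z i).2.2) with hφ
  have hsub : (Set.range fun k => pairTrace (halfSpaceErrors v (θ k)) z)
      ⊆ φ '' (𝒜 : Set (Finset (Fin n × Bool))) := by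
    rintro _ ⟨k, rfl⟩
    refine ⟨Finset.univ.filter fun i => 0 ≤ θ k ⬝ᵥ w i, ?_, ?_⟩
    · simp only [h𝒜, Finset.coe_filter, Finset.mem_univ, true_and, Set.mem_ofPred_eq,
        Finset.mem_filter]
      exact ⟨θ k, fun i => Iff.rfl⟩
    · funext i
      simp [hφ, pairTrace, halfSpaceErrors, sgn, w]
  calc _ ≤ (φ '' (𝒜 : Set (Finset (Fin n × Bool)))).ncard :=
        Set.ncard_le_ncard hsub (Set.toFinite _)
    _ ≤ (𝒜 : Set (Finset (Fin n × Bool))).ncard := Set.ncard_image_le (Set.toFinite _)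
    _ = 𝒜.card := Set.ncard_coe_finset _
    _ ≤ (Fintype.card (Fin n × Bool) + 1) ^ 3 :=
        card_halfSpaces_le w fun u hu => by simpa [h𝒜] using hu
    _ = (2 * n + 1) ^ 3 := by simp [mul_comm]

end HalfSpaces

/-! ### Approximation by half-spaces with rational normal vectors -/

section RationalApproximation

theorem exists_rat_seq_above (θ : Fin 3 → ℝ) :
    ∃ q : ℕ → Fin 3 → ℚ, (∀ k j, θ j ≤ q k j) ∧
      ∀ j, Tendsto (fun k => (q k j : ℝ)) atTop (𝓝 (θ j)) := by
  have h : ∀ (k : ℕ) (j : Fin 3), ∃ q : ℚ, θ j < q ∧ (q : ℝ) < θ j + 1 / ((k : ℝ) + 1) :=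
    fun k j => exists_rat_btwn (by linarith [Nat.one_div_pos_of_nat (α := ℝ) (n := k)])
  choose q hq hq' using h
  refine ⟨q, fun k j => (hq k j).le, fun j => ?_⟩
  refine tendsto_of_tendsto_of_tendsto_of_le_of_le tendsto_const_nhds ?_
    (fun k => (hq k j).le) (fun k => (hq' k j).le)
  simpa using tendsto_const_nhds.add (tendsto_one_div_add_atTop_nhds_zero_nat (𝕜 := ℝ))

/-- Approximation from above does not change the side on which a point with nonnegative features
ends up. -/
theorem eventually_sgn_eq {θ v : Fin 3 → ℝ} (hv : ∀ j, 0 ≤ v j) {q : ℕ → Fin 3 → ℚ}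
    (hq : ∀ k j, θ j ≤ q k j) (hlim : ∀ j, Tendsto (fun k => (q k j : ℝ)) atTop (𝓝 (θ j))) :
    ∀ᶠ k in atTop, sgn ((fun j => (q k j : ℝ)) ⬝ᵥ v) = sgn (θ ⬝ᵥ v) := by
  by_cases h : 0 ≤ θ ⬝ᵥ v
  · refine Eventually.of_forall fun k => ?_
    have : θ ⬝ᵥ v ≤ (fun j => (q k j : ℝ)) ⬝ᵥ v :=
      Finset.sum_le_sum fun j _ => mul_le_mul_of_nonneg_right (hq k j) (hv j)
    rw [sgn, sgn, if_pos h, if_pos (h.trans this)]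
  · have ht : Tendsto (fun k => (fun j => (q k j : ℝ)) ⬝ᵥ v) atTop (𝓝 (θ ⬝ᵥ v)) :=
      tendsto_finsetSum _ fun j _ => (hlim j).mul_const _
    filter_upwards [ht.eventually (gt_mem_nhds (not_le.1 h))] with k hk
    rw [sgn, sgn, if_neg h, if_neg (not_le.2 hk)]

instance measurableSingletonClass_int_units : MeasurableSingletonClass ℤˣ where
  measurableSet_singleton u := by
    have : ({u} : Set ℤˣ) = Units.val ⁻¹' {(u : ℤ)} := by
      ext; simp [Units.ext_iff]
    rw [this]
    exact measurableSet_preimage (comap_measurable _) (MeasurableSet.singleton _)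

theorem measurable_sgn : Measurable sgn :=
  Measurable.ite measurableSet_Ici measurable_const measurable_const

variable {X : Type*} [MeasurableSpace X]

theorem measurableSet_halfSpaceErrors {v : X → Fin 3 → ℝ} (hv : Measurable v) (θ : Fin 3 → ℝ) :
    MeasurableSet (halfSpaceErrors v θ) := by
  have h : Measurable fun z : X × ℤˣ => sgn (θ ⬝ᵥ v z.1) := by
    refine measurable_sgn.comp ?_
    unfold dotProduct
    fun_prop
  exact (measurableSet_eq_fun h measurable_snd).compl

/-- Supplies the countability that symmetrization needs for measurability. Approximating `θ` from
above makes the error sets converge pointwise, boundary included, so their measures converge and the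
finite sample is eventually treated alike. -/
theorem exists_rat_halfSpace {v : X → Fin 3 → ℝ} (hv : Measurable v) (hv0 : ∀ x j, 0 ≤ v x j)
    (P : Measure (X × ℤˣ)) [IsProbabilityMeasure P] {n : ℕ} (S : Dataset X n) (θ : Fin 3 → ℝ)
    {r : ℝ≥0∞} (hS : ∀ i, S i ∉ halfSpaceErrors v θ) (hr : r < P (halfSpaceErrors v θ)) :
    ∃ q : Fin 3 → ℚ, (∀ i, S i ∉ halfSpaceErrors v (fun j => q j)) ∧
      r < P (halfSpaceErrors v fun j => q j) := by
  obtain ⟨q, hq, hlim⟩ := exists_rat_seq_above θ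
  have hev : ∀ z : X × ℤˣ, ∀ᶠ k in atTop,
      (z ∈ halfSpaceErrors v (fun j => (q k j : ℝ)) ↔ z ∈ halfSpaceErrors v θ) := fun z => by
    filter_upwards [eventually_sgn_eq (hv0 z.1) hq hlim] with k hk
    simp [halfSpaceErrors, hk]
  have ht := tendsto_measure_of_tendsto_indicator_of_isFiniteMeasure atTop P
    (fun k => measurableSet_halfSpaceErrors hv fun j => (q k j : ℝ)) hev
  obtain ⟨k, hk, hk'⟩ := ((ht.eventually (lt_mem_nhds hr)).and
    (eventually_all.2 fun i => hev (S i))).exists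
  exact ⟨q k, fun i hi => hS i ((hk' i).1 hi), hk⟩

end RationalApproximation

/-! ### Sample complexity of empirical risk minimization -/

section UpperBound

theorem exists_sampleSize {ε δ : ℝ} (hε : 0 < ε) (hε2 : ε ≤ 1 / 2) (hδ : 0 < δ) (hδ1 : δ < 1) :
    ∃ n : ℕ, (n : ℝ) ≤ 130 * (1 / ε * (Real.log (1 / ε) + Real.log (1 / δ))) ∧
      (2 * n + 1 : ℝ) ^ 3 ≤ δ * (1 + ε) ^ n := by
  set L := Real.log (1 / ε) + Real.log (1 / δ) with hL
  have hlogδ : 0 < Real.log (1 / δ) := Real.log_pos (by rw [lt_div_iff₀ hδ]; linarith)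
  have hlogε : Real.log 2 ≤ Real.log (1 / ε) :=
    Real.log_le_log (by norm_num) (by rw [le_div_iff₀ hε]; linarith)
  have hlog2 := Real.log_two_gt_d9
  have hLpos : 0 < L := by linarith
  have hLε : 1 ≤ 1 / ε * L := by
    have h2 : 2 ≤ 1 / ε := by rw [le_div_iff₀ hε]; linarith
    nlinarith
  -- With this `n`, `3 * log (2 n + 1) ≤ 33 L`, while `n * log (1 + ε) ≥ 64 L`; the slack covers
  -- `log (1 / δ) ≤ L`.
  set n := ⌈128 * (1 / ε * L)⌉₊ with hn
  have hn1 : 128 * (1 / ε * L) ≤ n := Nat.le_ceil _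
  have hn2 : (n : ℝ) < 128 * (1 / ε * L) + 1 := Nat.ceil_lt_add_one (by positivity)
  refine ⟨n, by linarith, ?_⟩
  have hlog1 : ε / 2 ≤ Real.log (1 + ε) := by
    have h := Real.one_sub_inv_le_log_of_pos (by linarith : 0 < 1 + ε)
    refine le_trans ?_ h
    have : (1 + ε) * (1 + ε)⁻¹ = 1 := mul_inv_cancel₀ (by linarith)
    have h3 : (1 + ε)⁻¹ ≤ 1 - ε / 2 := by
      rw [inv_le_iff_one_le_mul₀' (by linarith)]
      nlinarith
    linarith
  have hsize : Real.log (2 * n + 1) ≤ 11 * L := by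
    calc Real.log (2 * n + 1) ≤ Real.log (2 ^ 9 * (1 / ε * L)) :=
          Real.log_le_log (by positivity) (by linarith)
      _ = 9 * Real.log 2 + (Real.log (1 / ε) + Real.log L) := by
          rw [Real.log_mul (by positivity) (by positivity),
            Real.log_mul (by positivity) hLpos.ne', Real.log_pow]
          norm_num
      _ ≤ 11 * L := by linarith [Real.log_le_sub_one_of_pos hLpos]
  have hn3 : 64 * L ≤ n * (ε / 2) := by
    calc 64 * L = 128 * (1 / ε * L) * (ε / 2) := by field_simp; norm_num
      _ ≤ n * (ε / 2) := by gcongr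
  rw [← Real.log_le_log_iff (by positivity) (by positivity), Real.log_pow,
    Real.log_mul hδ.ne' (by positivity), Real.log_pow]
  have h4 : (n : ℝ) * (ε / 2) ≤ n * Real.log (1 + ε) := by gcongr
  have h5 : Real.log (1 / δ) = -Real.log δ := by rw [one_div, Real.log_inv]
  push_cast
  linarith

variable {d : ℕ}

/-- The features of the network with nonnegative entries, including the constant one. -/
def quadFeature (x : EuclideanSpace ℝ (Fin (2 * d))) : Fin 3 → ℝ := ![blockSq x 0, blockSq x 1, 1]

theorem measurable_quadFeature :
    Measurable (quadFeature : EuclideanSpace ℝ (Fin (2 * d)) → Fin 3 → ℝ) := by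
  refine measurable_pi_iff.2 fun j => ?_
  fin_cases j
  · exact measurable_blockSq 0
  · exact measurable_blockSq 1
  · exact measurable_const

theorem quadFeature_nonneg (x : EuclideanSpace ℝ (Fin (2 * d))) (j : Fin 3) :
    0 ≤ quadFeature x j := by
  fin_cases j
  · exact blockSq_nonneg x 0
  · exact blockSq_nonneg x 1
  · exact zero_le_one

theorem exists_normal_of_mem_cnnClass {h : EuclideanSpace ℝ (Fin (2 * d)) → ℤˣ}
    (hh : h ∈ cnnClass 1 2 d squarePool) :
    ∃ θ : Fin 3 → ℝ, ∀ x, h x = sgn (θ ⬝ᵥ quadFeature x) := by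
  obtain ⟨W, rfl⟩ := hh
  refine ⟨![W.1 0 ^ 2 * W.2.1 0, W.1 0 ^ 2 * W.2.1 1, W.2.2], fun x => ?_⟩
  change sgn (cnn squarePool W x) = _
  rw [cnn_eq]
  congr 1
  simp [dotProduct, Fin.sum_univ_three, quadFeature]
  ring

theorem measurable_target : Measurable (target d) := by
  have : target d = fun x => sgn (blockSq x 0 - blockSq x 1) := funext target_eq
  rw [this]
  exact measurable_sgn.comp (by fun_prop)

theorem err_deterministic {X : Type*} [MeasurableSpace X] (P : Measure (X × ℤˣ))
    (A : (n : ℕ) → Dataset X n → (X → ℤˣ)) {n : ℕ} (S : Dataset X n)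
    (hm : MeasurableSet {z : X × ℤˣ | A n S z.1 ≠ z.2}) :
    err P (deterministic A n S) = P {z | A n S z.1 ≠ z.2} := by
  rw [err, ← lintegral_indicator_one hm]
  refine lintegral_congr fun z => ?_
  have : MeasurableSet {h : X → ℤˣ | h z.1 ≠ z.2} :=
    (measurableSet_eq_fun (measurable_pi_apply z.1) measurable_const).compl
  change Measure.dirac (A n S) {h : X → ℤˣ | h z.1 ≠ z.2} = _
  rw [Measure.dirac_apply' _ this]
  by_cases hz : A n S z.1 = z.2 <;> simp [hz]

theorem ae_label_eq {X : Type*} [MeasurableSpace X] {h : X → ℤˣ} (hh : Measurable h)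
    (PX : Measure X) : ∀ᵐ z ∂(PX.map fun x => (x, h x)), h z.1 = z.2 := by
  have hs : MeasurableSet {z : X × ℤˣ | h z.1 = z.2} :=
    measurableSet_eq_fun (hh.comp measurable_fst) measurable_snd
  rw [ae_map_iff (by fun_prop) hs]
  exact Eventually.of_forall fun _ => rfl

theorem measure_err_gt_mul_le (A : (n : ℕ) → Dataset (EuclideanSpace ℝ (Fin (2 * d))) n →
      (EuclideanSpace ℝ (Fin (2 * d)) → ℤˣ)) (hA : IsERM (cnnClass 1 2 d squarePool) A)
    {P : Measure (EuclideanSpace ℝ (Fin (2 * d)) × ℤˣ)} (hP : P ∈ allDistributions (target d))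
    (n : ℕ) (r : ℝ≥0∞) :
    Measure.pi (fun _ : Fin n => P) {S | r < err P (deterministic A n S)} * (1 + r) ^ n
      ≤ ((2 * n + 1) ^ 3 : ℕ) := by
  obtain ⟨PX, hPX, rfl⟩ := hP
  set P := PX.map fun x => (x, target d x) with hPdef
  have hmeas : Measurable fun x => (x, target d x) := measurable_id.prodMk measurable_target
  have : IsProbabilityMeasure P := Measure.isProbabilityMeasure_map hmeas.aemeasurable
  have hmain := measure_exists_consistent_mul_le (κ := Fin 3 → ℚ) P
    (D := fun q => halfSpaceErrors quadFeature fun j => (q j : ℝ))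
    (fun q => measurableSet_halfSpaceErrors measurable_quadFeature _)
    (n := n) (fun z => ncard_range_pairTrace_le quadFeature _ z) r
  refine le_trans (mul_le_mul' ?_ le_rfl) hmain
  have hlabel : ∀ᵐ S ∂(Measure.pi fun _ : Fin n => P), ∀ i, target d (S i).1 = (S i).2 := by
    refine ae_all_iff.2 fun i => ?_
    exact (measurePreserving_eval (fun _ : Fin n => P) i).quasiMeasurePreserving.ae
      (ae_label_eq measurable_target PX)
  -- The learner is arbitrary, so the bad event may be non-measurable; almost-everywhere inclusion
  -- in a measurable event is enough.
  refine measure_mono_ae (μ := Measure.pi fun _ : Fin n => P) ?_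
  filter_upwards [hlabel] with S hS hbad
  obtain ⟨hmem, hmin⟩ := hA n S
  obtain ⟨θ, hθ⟩ := exists_normal_of_mem_cnnClass hmem
  have hset : {z : _ × ℤˣ | A n S z.1 ≠ z.2} = halfSpaceErrors quadFeature θ := by
    ext z; simp [halfSpaceErrors, hθ]
  have hfit : ∀ i, A n S (S i).1 = (S i).2 := by
    have h0 : empiricalErrors S (target d) = 0 := by simp [empiricalErrors, hS]
    have h1 := hmin _ target_mem_cnnClass
    rw [h0, Nat.le_zero, empiricalErrors, Finset.card_eq_zero, Finset.filter_eq_empty_iff] at h1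
    exact fun i => not_not.1 (h1 (Finset.mem_univ i))
  refine exists_rat_halfSpace measurable_quadFeature quadFeature_nonneg P S θ (fun i => ?_) ?_
  · rw [← hset]
    simpa using hfit i
  · change r < err P (deterministic A n S) at hbad
    rwa [err_deterministic _ _ _
      (hset ▸ measurableSet_halfSpaceErrors measurable_quadFeature θ), hset] at hbad

theorem sampleComplexity_le_of_isERM (A : (n : ℕ) → Dataset (EuclideanSpace ℝ (Fin (2 * d))) n →
      (EuclideanSpace ℝ (Fin (2 * d)) → ℤˣ)) (hA : IsERM (cnnClass 1 2 d squarePool) A)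
    {ε δ : ℝ} (hε : 0 < ε) (hε2 : ε ≤ 1 / 2) (hδ : 0 < δ) (hδ1 : δ < 1) :
    ((sampleComplexity (deterministic A) (allDistributions (target d)) ε δ : ℕ∞) : ℝ≥0∞) ≤
      ENNReal.ofReal (130 * (1 / ε * (Real.log (1 / ε) + Real.log (1 / δ)))) := by
  obtain ⟨n, hn, hbound⟩ := exists_sampleSize hε hε2 hδ hδ1
  have hle : sampleComplexity (deterministic A) (allDistributions (target d)) ε δ ≤ n := by
    refine sInf_le ⟨n, fun P hP => ?_, rfl⟩
    have h1 := measure_err_gt_mul_le A hA hP n (ENNReal.ofReal ε)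
    have h2 : (((2 * n + 1) ^ 3 : ℕ) : ℝ≥0∞)
        ≤ ENNReal.ofReal δ * (1 + ENNReal.ofReal ε) ^ n := by
      rw [← ENNReal.ofReal_one, ← ENNReal.ofReal_add zero_le_one hε.le,
        ← ENNReal.ofReal_pow (by positivity), ← ENNReal.ofReal_mul hδ.le,
        ← ENNReal.ofReal_natCast]
      refine ENNReal.ofReal_le_ofReal ?_
      exact_mod_cast hbound
    exact (ENNReal.mul_le_mul_iff_left (by simp) (by finiteness)).1 (h1.trans h2)
  calc ((sampleComplexity (deterministic A) (allDistributions (target d)) ε δ : ℕ∞) : ℝ≥0∞)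
      ≤ ((n : ℕ∞) : ℝ≥0∞) := ENat.toENNReal_mono hle
    _ = ENNReal.ofReal n := by simp
    _ ≤ _ := ENNReal.ofReal_le_ofReal hn

end UpperBound

/-! ### Orthogonal matrices with prescribed signs above the diagonal -/

section Cayley

variable {ι : Type*} [Fintype ι] [DecidableEq ι]

/-- For skew `B` the factors `1 + B` and `1 - B` are transposes of each other, and they commute. -/
theorem cayley_orthogonal {B : Matrix ι ι ℝ} (hB : B.transpose = -B)
    (hdet : IsUnit (1 - B).det) :
    ((1 + B) * (1 - B)⁻¹).transpose * ((1 + B) * (1 - B)⁻¹) = 1 := by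
  have ht : (1 - B).transpose = 1 + B := by
    rw [Matrix.transpose_sub, hB, Matrix.transpose_one, sub_neg_eq_add]
  have ht' : (1 + B).transpose = 1 - B := by rw [← ht, Matrix.transpose_transpose]
  have hdet' : IsUnit (1 + B).det := by rwa [← ht, Matrix.det_transpose]
  have hcomm : (1 - B) * (1 + B) = (1 + B) * (1 - B) := by noncomm_ring
  rw [Matrix.transpose_mul, Matrix.transpose_nonsing_inv, ht, ht', Matrix.mul_assoc,
    ← Matrix.mul_assoc (1 - B), hcomm, Matrix.mul_assoc (1 + B), Matrix.mul_nonsing_inv _ hdet,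
    Matrix.mul_one, Matrix.nonsing_inv_mul _ hdet']

theorem exists_orthogonal_sgn_eq [LinearOrder ι] (b : ι → ι → ℤˣ) :
    ∃ Q : Matrix ι ι ℝ, Q.transpose * Q = 1 ∧ ∀ i j, i < j → sgn (Q i j) = b i j := by
  -- Off the diagonal, the Cayley transform of `t • B` is `2 t B` to first order, so for small `t >
  -- 0` it has the signs of `B` above the diagonal.
  set B : Matrix ι ι ℝ := Matrix.of fun i j =>
    if i < j then ((b i j : ℤ) : ℝ) else if j < i then -((b j i : ℤ) : ℝ) else 0 with hBdef
  have hB : B.transpose = -B := by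
    ext i j
    rcases lt_trichotomy i j with h | rfl | h
    · simp [hBdef, h, h.not_gt]
    · simp [hBdef]
    · simp [hBdef, h, h.not_gt]
  have hdet : Tendsto (fun t : ℝ => (1 - t • B).det) (𝓝 0) (𝓝 1) := by
    have h : Continuous fun t : ℝ => (1 - t • B).det := by fun_prop
    simpa using h.tendsto 0
  have hinv : Tendsto (fun t : ℝ => B * (1 - t • B)⁻¹) (𝓝 0) (𝓝 B) := by
    have hadj : Tendsto (fun t : ℝ => (1 - t • B).adjugate) (𝓝 0) (𝓝 1) := by
      have h : Continuous fun t : ℝ => (1 - t • B).adjugate := by fun_prop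
      simpa using h.tendsto 0
    have h : Tendsto (fun t : ℝ => B * ((1 - t • B).det⁻¹ • (1 - t • B).adjugate)) (𝓝 0)
        (𝓝 (B * ((1 : ℝ)⁻¹ • (1 : Matrix ι ι ℝ)))) :=
      ((hdet.inv₀ one_ne_zero).smul hadj).const_mul B
    simpa [Matrix.inv_def, Ring.inverse_eq_inv'] using h
  have hsign : ∀ i j, i < j → ∀ᶠ t in 𝓝 (0 : ℝ), 0 < ((b i j : ℤ) : ℝ) * (B * (1 - t • B)⁻¹) i j := by
    intro i j hij
    have h : Tendsto (fun t : ℝ => ((b i j : ℤ) : ℝ) * (B * (1 - t • B)⁻¹) i j) (𝓝 0)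
        (𝓝 (((b i j : ℤ) : ℝ) * B i j)) :=
      ((tendsto_pi_nhds.1 (tendsto_pi_nhds.1 hinv i)) j).const_mul _
    refine h.eventually (lt_mem_nhds ?_)
    rcases Int.units_eq_one_or (b i j) with hb | hb <;> simp [hBdef, hij, hb]
  have hev : ∀ᶠ t in 𝓝[>] (0 : ℝ), 0 < t ∧ 0 < (1 - t • B).det ∧
      ∀ i j, i < j → 0 < ((b i j : ℤ) : ℝ) * (B * (1 - t • B)⁻¹) i j := by
    refine eventually_mem_nhdsWithin.and (Eventually.and ?_ ?_)
    · exact nhdsWithin_le_nhds (hdet.eventually (lt_mem_nhds one_pos))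
    · refine nhdsWithin_le_nhds (eventually_all.2 fun i => eventually_all.2 fun j => ?_)
      by_cases hij : i < j
      · simpa [hij] using hsign i j hij
      · simp [hij]
  obtain ⟨t, ht, htdet, hts⟩ := hev.exists
  have hu : IsUnit (1 - t • B).det := isUnit_iff_ne_zero.2 htdet.ne'
  refine ⟨(1 + t • B) * (1 - t • B)⁻¹, cayley_orthogonal ?_ hu, fun i j hij => ?_⟩
  · rw [Matrix.transpose_smul, hB, smul_neg]
  · have hexp : (1 + t • B) * (1 - t • B)⁻¹ = 1 + (2 * t) • (B * (1 - t • B)⁻¹) := by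
      have h1 : 1 + t • B = (1 - t • B) + (2 * t) • B := by module
      rw [h1, Matrix.add_mul, Matrix.mul_nonsing_inv _ hu, Matrix.smul_mul]
    refine sgn_mul_pos ?_
    rw [hexp]
    have := mul_pos (mul_pos two_pos ht) (hts i j hij)
    simp only [Matrix.add_apply, Matrix.one_apply_ne hij.ne, Matrix.smul_apply, smul_eq_mul,
      zero_add]
    linarith

end Cayley

/-! ### Orthogonal maps that move the target -/

section Rotations

variable {d : ℕ}

/-- The vector with the given two halves. -/
def joinBlocks (u v : Fin d → ℝ) : EuclideanSpace ℝ (Fin (2 * d)) :=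
  WithLp.toLp 2 fun k => if (finProdFinEquiv.symm k).1 = 0 then u (finProdFinEquiv.symm k).2
    else v (finProdFinEquiv.symm k).2

/-- One of the two halves of a vector. -/
def block (x : EuclideanSpace ℝ (Fin (2 * d))) (i : Fin 2) (l : Fin d) : ℝ :=
  x (finProdFinEquiv (i, l))

theorem block_joinBlocks_zero (u v : Fin d → ℝ) : block (joinBlocks u v) 0 = u := by
  funext l
  simp only [block, joinBlocks, Equiv.symm_apply_apply]
  simp

theorem block_joinBlocks_one (u v : Fin d → ℝ) : block (joinBlocks u v) 1 = v := by
  funext l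
  simp only [block, joinBlocks, Equiv.symm_apply_apply]
  simp

theorem blockSq_eq_dotProduct (x : EuclideanSpace ℝ (Fin (2 * d))) (i : Fin 2) :
    blockSq x i = block x i ⬝ᵥ block x i := by
  simp [blockSq, block, dotProduct, sq]

theorem norm_sq_eq_blockSq (x : EuclideanSpace ℝ (Fin (2 * d))) :
    ‖x‖ ^ 2 = blockSq x 0 + blockSq x 1 := by
  rw [EuclideanSpace.real_norm_sq_eq, ← finProdFinEquiv.sum_comp, Fintype.sum_prod_type,
    Fin.sum_univ_two]
  rfl

/-- The map `(u, v) ↦ ((u + Q v) / √2, (u - Q v) / √2)`. -/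
noncomputable def mixBlocks (Q : Matrix (Fin d) (Fin d) ℝ) :
    EuclideanSpace ℝ (Fin (2 * d)) →ₗ[ℝ] EuclideanSpace ℝ (Fin (2 * d)) where
  toFun x := joinBlocks ((√2)⁻¹ • (block x 0 + Q.mulVec (block x 1)))
    ((√2)⁻¹ • (block x 0 - Q.mulVec (block x 1)))
  map_add' x y := by
    have h : ∀ i, block (x + y) i = block x i + block y i := fun i => rfl
    simp only [h, Matrix.mulVec_add]
    ext k
    simp only [joinBlocks, PiLp.add_apply, Pi.smul_apply, Pi.add_apply, Pi.sub_apply, smul_eq_mul]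
    split_ifs <;> ring
  map_smul' c x := by
    have h : ∀ i, block (c • x) i = c • block x i := fun i => rfl
    simp only [h, Matrix.mulVec_smul]
    ext k
    simp only [joinBlocks, PiLp.smul_apply, Pi.smul_apply, Pi.add_apply, Pi.sub_apply, smul_eq_mul,
      RingHom.id_apply]
    split_ifs <;> ring

theorem blockSq_mixBlocks_zero (Q : Matrix (Fin d) (Fin d) ℝ)
    (x : EuclideanSpace ℝ (Fin (2 * d))) :
    blockSq (mixBlocks Q x) 0 = (block x 0 ⬝ᵥ block x 0
      + Q.mulVec (block x 1) ⬝ᵥ Q.mulVec (block x 1)) / 2 + block x 0 ⬝ᵥ Q.mulVec (block x 1) := by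
  have h2 : (√2)⁻¹ * (√2)⁻¹ = (2 : ℝ)⁻¹ := by
    rw [← mul_inv, Real.mul_self_sqrt zero_le_two]
  rw [blockSq_eq_dotProduct]
  simp only [mixBlocks, LinearMap.coe_mk, AddHom.coe_mk, block_joinBlocks_zero, smul_dotProduct,
    dotProduct_smul, smul_eq_mul, add_dotProduct, dotProduct_add]
  rw [dotProduct_comm (Q.mulVec (block x 1)) (block x 0)]
  linear_combination (block x 0 ⬝ᵥ block x 0 + 2 * block x 0 ⬝ᵥ Q.mulVec (block x 1)
    + Q.mulVec (block x 1) ⬝ᵥ Q.mulVec (block x 1)) * h2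

theorem blockSq_mixBlocks_one (Q : Matrix (Fin d) (Fin d) ℝ)
    (x : EuclideanSpace ℝ (Fin (2 * d))) :
    blockSq (mixBlocks Q x) 1 = (block x 0 ⬝ᵥ block x 0
      + Q.mulVec (block x 1) ⬝ᵥ Q.mulVec (block x 1)) / 2 - block x 0 ⬝ᵥ Q.mulVec (block x 1) := by
  have h2 : (√2)⁻¹ * (√2)⁻¹ = (2 : ℝ)⁻¹ := by
    rw [← mul_inv, Real.mul_self_sqrt zero_le_two]
  rw [blockSq_eq_dotProduct]
  simp only [mixBlocks, LinearMap.coe_mk, AddHom.coe_mk, block_joinBlocks_one, smul_dotProduct,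
    dotProduct_smul, smul_eq_mul, sub_dotProduct, dotProduct_sub]
  rw [dotProduct_comm (Q.mulVec (block x 1)) (block x 0)]
  linear_combination (block x 0 ⬝ᵥ block x 0 - 2 * block x 0 ⬝ᵥ Q.mulVec (block x 1)
    + Q.mulVec (block x 1) ⬝ᵥ Q.mulVec (block x 1)) * h2

theorem exists_isometry_target_eq {Q : Matrix (Fin d) (Fin d) ℝ} (hQ : Q.transpose * Q = 1) :
    ∃ g : EuclideanSpace ℝ (Fin (2 * d)) ≃ₗᵢ[ℝ] EuclideanSpace ℝ (Fin (2 * d)),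
      ∀ u v, target d (g (joinBlocks u v)) = sgn (u ⬝ᵥ Q.mulVec v) := by
  have hnorm : ∀ v : Fin d → ℝ, Q.mulVec v ⬝ᵥ Q.mulVec v = v ⬝ᵥ v := fun v => by
    rw [Matrix.dotProduct_mulVec, ← Matrix.mulVec_transpose, Matrix.mulVec_mulVec, hQ,
      Matrix.one_mulVec]
  let f : EuclideanSpace ℝ (Fin (2 * d)) →ₗᵢ[ℝ] EuclideanSpace ℝ (Fin (2 * d)) :=
    ⟨mixBlocks Q, fun x => by
      rw [← sq_eq_sq₀ (norm_nonneg _) (norm_nonneg _), norm_sq_eq_blockSq, norm_sq_eq_blockSq,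
        blockSq_mixBlocks_zero, blockSq_mixBlocks_one, hnorm, blockSq_eq_dotProduct,
        blockSq_eq_dotProduct]
      ring⟩
  refine ⟨f.toLinearIsometryEquiv rfl, fun u v => ?_⟩
  change target d (mixBlocks Q (joinBlocks u v)) = _
  rw [target_eq, blockSq_mixBlocks_zero, blockSq_mixBlocks_one, block_joinBlocks_zero,
    block_joinBlocks_one]
  have : ∀ a s : ℝ, sgn (a + s - (a - s)) = sgn s := fun a s => by
    have : 0 ≤ a + s - (a - s) ↔ 0 ≤ s := by constructor <;> intro h <;> linarith
    simp only [sgn, this]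
  exact this _ _

theorem target_zero : target d 0 = 1 := by
  simp [target, sgn]

/-- Pairs `i < j` of indices below `d`, listed as `j` and then `i`. -/
abbrev IndexPair (d : ℕ) : Type := Σ j : Fin d, Fin j

theorem card_indexPair_mul_two (d : ℕ) : Fintype.card (IndexPair d) * 2 = d * (d - 1) := by
  simp only [Fintype.card_sigma, Fintype.card_fin]
  rw [Fin.sum_univ_eq_sum_range (fun j => j), Finset.sum_range_id_mul_two]

/-- The point `(e_i, e_j)`. -/
def pairPoint (k : IndexPair d) : EuclideanSpace ℝ (Fin (2 * d)) :=
  joinBlocks (Pi.single (Fin.castLE k.1.isLt.le k.2) 1) (Pi.single k.1 1)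

theorem exists_isometry_target_pairPoint (b : IndexPair d → ℤˣ) :
    ∃ g : EuclideanSpace ℝ (Fin (2 * d)) ≃ₗᵢ[ℝ] EuclideanSpace ℝ (Fin (2 * d)),
      ∀ k, target d (g (pairPoint k)) = b k := by
  obtain ⟨Q, hQ, hsgn⟩ := exists_orthogonal_sgn_eq fun i j : Fin d =>
    if h : i < j then b ⟨j, ⟨i, h⟩⟩ else 1
  obtain ⟨g, hg⟩ := exists_isometry_target_eq hQ
  refine ⟨g, fun k => ?_⟩
  obtain ⟨j, i⟩ := k
  have hij : Fin.castLE j.isLt.le i < j := i.isLt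
  rw [pairPoint, hg]
  have h := hsgn _ _ hij
  rw [dif_pos hij] at h
  simpa using h

/-- Taking `Q = 1` and `Q = -1` gives both labels to `(e_0, e_0)`. Unlike the points `(e_i, e_j)`
with `i < j`, this works for `d = 1`. -/
theorem exists_isometry_target_single (hd : 1 ≤ d) :
    ∃ x : EuclideanSpace ℝ (Fin (2 * d)), ∀ y : ℤˣ,
      ∃ g : EuclideanSpace ℝ (Fin (2 * d)) ≃ₗᵢ[ℝ] EuclideanSpace ℝ (Fin (2 * d)),
        target d (g x) = y := by
  set e : Fin d → ℝ := Pi.single ⟨0, hd⟩ 1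
  refine ⟨joinBlocks e e, fun y => ?_⟩
  rcases Int.units_eq_one_or y with rfl | rfl
  · obtain ⟨g, hg⟩ := exists_isometry_target_eq (Q := (1 : Matrix (Fin d) (Fin d) ℝ)) (by simp)
    exact ⟨g, by simp [hg, e, sgn]⟩
  · obtain ⟨g, hg⟩ := exists_isometry_target_eq (Q := (-1 : Matrix (Fin d) (Fin d) ℝ)) (by simp)
    exact ⟨g, by simp [hg, e, sgn]⟩

end Rotations

/-! ### Discrete distributions -/

section Discrete

variable {X ι : Type*}

/-- The probability that the random hypothesis trained on `S` does not map `x` to `y`. -/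
noncomputable def mistakeProb (A : LearningAlgorithm X) {n : ℕ} (S : Dataset X n) (x : X)
    (y : ℤˣ) : ℝ :=
  (A n S : Measure (X → ℤˣ)).real {h | h x ≠ y}

theorem measurableSet_apply_ne (x : X) (y : ℤˣ) : MeasurableSet {h : X → ℤˣ | h x ≠ y} :=
  (measurableSet_eq_fun (measurable_pi_apply x) measurable_const).compl

theorem mistakeProb_nonneg (A : LearningAlgorithm X) {n : ℕ} (S : Dataset X n) (x : X) (y : ℤˣ) :
    0 ≤ mistakeProb A S x y :=
  measureReal_nonneg

theorem mistakeProb_le_one (A : LearningAlgorithm X) {n : ℕ} (S : Dataset X n) (x : X) (y : ℤˣ) :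
    mistakeProb A S x y ≤ 1 :=
  measureReal_le_one

theorem mistakeProb_add_neg (A : LearningAlgorithm X) {n : ℕ} (S : Dataset X n) (x : X)
    (y : ℤˣ) : mistakeProb A S x y + mistakeProb A S x (-y) = 1 := by
  have h : {h : X → ℤˣ | h x ≠ -y} = {h : X → ℤˣ | h x ≠ y}ᶜ := by
    ext h
    rcases Int.units_eq_one_or (h x) with h1 | h1 <;> rcases Int.units_eq_one_or y with h2 | h2 <;>
      simp [h1, h2]
  rw [mistakeProb, mistakeProb, h, probReal_add_probReal_compl (measurableSet_apply_ne x y)]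

variable [Fintype ι]

/-- The discrete measure with the given nonnegative weights at the given points. -/
noncomputable def weightedDirac {Z : Type*} [MeasurableSpace Z] (p : ι → ℝ) (z : ι → Z) :
    Measure Z :=
  ∑ j, ENNReal.ofReal (p j) • Measure.dirac (z j)

theorem weightedDirac_apply {Z : Type*} [MeasurableSpace Z] (p : ι → ℝ) (z : ι → Z) {s : Set Z}
    (hs : MeasurableSet s) :
    weightedDirac p z s = ∑ j, ENNReal.ofReal (p j) * s.indicator 1 (z j) := by
  simp [weightedDirac, Measure.finsetSum_apply, Measure.dirac_apply' _ hs]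

theorem map_weightedDirac {Y Z : Type*} [MeasurableSpace Y] [MeasurableSpace Z] (p : ι → ℝ)
    (z : ι → Y) {f : Y → Z} (hf : Measurable f) :
    (weightedDirac p z).map f = weightedDirac p fun j => f (z j) := by
  ext s hs
  rw [Measure.map_apply hf hs, weightedDirac_apply _ _ hs, weightedDirac_apply _ _ (hf hs)]
  rfl

theorem isProbabilityMeasure_weightedDirac {Z : Type*} [MeasurableSpace Z] {p : ι → ℝ}
    (hp0 : ∀ j, 0 ≤ p j) (hp1 : ∑ j, p j = 1) (z : ι → Z) :
    IsProbabilityMeasure (weightedDirac p z) := by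
  constructor
  rw [weightedDirac_apply _ _ MeasurableSet.univ]
  simp [← ENNReal.ofReal_sum_of_nonneg (fun j _ => hp0 j), hp1]

theorem lintegral_weightedDirac {Z : Type*} [MeasurableSpace Z] [MeasurableSingletonClass Z]
    (p : ι → ℝ) (z : ι → Z) (f : Z → ℝ≥0∞) :
    ∫⁻ a, f a ∂(weightedDirac p z) = ∑ j, ENNReal.ofReal (p j) * f (z j) := by
  simp [weightedDirac, lintegral_finsetSum_measure]

open Classical in
-- The sample law is the image of the law of the random index sequence. Only an inequality is
-- claimed because `s` need not be measurable.
theorem sum_weights_le_pi_weightedDirac {Z : Type*} [MeasurableSpace Z] {p : ι → ℝ}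
    (hp0 : ∀ j, 0 ≤ p j) (hp1 : ∑ j, p j = 1) (z : ι → Z) {n : ℕ} (s : Set (Fin n → Z)) :
    ENNReal.ofReal (∑ J : Fin n → ι with (fun i => z (J i)) ∈ s, ∏ i, p (J i))
      ≤ Measure.pi (fun _ : Fin n => weightedDirac p z) s := by
  let _ : MeasurableSpace ι := ⊤
  set ν : Measure ι := weightedDirac p id with hν
  have hνp : IsProbabilityMeasure ν := isProbabilityMeasure_weightedDirac hp0 hp1 id
  have hz : Measurable z := measurable_from_top
  have hmap : ν.map z = weightedDirac p z := map_weightedDirac p id hz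
  have hzp : IsProbabilityMeasure (weightedDirac p z) :=
    isProbabilityMeasure_weightedDirac hp0 hp1 z
  have hpi : MeasurePreserving (fun (J : Fin n → ι) i => z (J i)) (Measure.pi fun _ => ν)
      (Measure.pi fun _ => weightedDirac p z) :=
    measurePreserving_pi _ _ fun _ => ⟨hz, hmap⟩
  rw [← hpi.map_eq]
  refine le_trans ?_ (Measure.le_map_apply hpi.measurable.aemeasurable s)
  have hsingle : ∀ j, ν {j} = ENNReal.ofReal (p j) := fun j => by
    rw [hν, weightedDirac_apply _ _ (MeasurableSet.singleton j)]
    simp [Set.indicator_apply]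
  have hset : ((fun (J : Fin n → ι) i => z (J i)) ⁻¹' s)
      = ((Finset.univ.filter fun J : Fin n → ι => (fun i => z (J i)) ∈ s : Finset _) :
        Set (Fin n → ι)) := by
    ext J; simp
  rw [hset, ← sum_measure_singleton, ENNReal.ofReal_sum_of_nonneg
    fun J _ => Finset.prod_nonneg fun i _ => hp0 _]
  refine Finset.sum_le_sum fun J _ => ?_
  rw [Measure.pi_singleton, ENNReal.ofReal_prod_of_nonneg fun i _ => hp0 _]
  simp [hsingle]

end Discrete

/-! ### Lower bounds for equivariant algorithms -/

section LowerBound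

variable {d : ℕ}

/-- `n` samples suffice to reach error `ε` with confidence `1 - δ` on every distribution. -/
def Suffices {X : Type*} [MeasurableSpace X] (A : LearningAlgorithm X)
    (Prob : Set (Measure (X × ℤˣ))) (ε δ : ℝ) (n : ℕ) : Prop :=
  ∀ P ∈ Prob, Measure.pi (fun _ : Fin n => P) {S : Dataset X n | ENNReal.ofReal ε < err P (A n S)}
    ≤ ENNReal.ofReal δ

theorem OrthogonalEquivariant.measure_apply_ne {m : ℕ}
    {A : LearningAlgorithm (EuclideanSpace ℝ (Fin m))} (hA : OrthogonalEquivariant A)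
    (g : EuclideanSpace ℝ (Fin m) ≃ₗᵢ[ℝ] EuclideanSpace ℝ (Fin m)) {n : ℕ}
    (S : Dataset (EuclideanSpace ℝ (Fin m)) n) (x : EuclideanSpace ℝ (Fin m)) (y : ℤˣ) :
    (A n fun i => (g (S i).1, (S i).2) : Measure (EuclideanSpace ℝ (Fin m) → ℤˣ))
      {h | h (g x) ≠ y} = ENNReal.ofReal (mistakeProb A S x y) := by
  rw [mistakeProb, ofReal_measureReal, ← hA g n S,
    Measure.map_apply (by fun_prop) (measurableSet_apply_ne x y)]
  rfl

open Classical in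
/-- By equivariance, an algorithm that learns the target from every distribution also learns each
rotated target `target d ∘ g` from every discrete distribution. -/
theorem Suffices.sum_weights_le {A : LearningAlgorithm (EuclideanSpace ℝ (Fin (2 * d)))}
    (hA : OrthogonalEquivariant A) {ε δ : ℝ} (hε : 0 ≤ ε) (hδ : 0 ≤ δ) {n : ℕ}
    (hn : Suffices A (allDistributions (target d)) ε δ n) {ι : Type*} [Fintype ι] {p : ι → ℝ}
    (hp0 : ∀ j, 0 ≤ p j) (hp1 : ∑ j, p j = 1) (x : ι → EuclideanSpace ℝ (Fin (2 * d)))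
    (g : EuclideanSpace ℝ (Fin (2 * d)) ≃ₗᵢ[ℝ] EuclideanSpace ℝ (Fin (2 * d))) {b : ι → ℤˣ}
    (hb : ∀ j, target d (g (x j)) = b j) :
    ∑ J : Fin n → ι with ε < ∑ j, p j * mistakeProb A (fun i => (x (J i), b (J i))) (x j) (b j),
      ∏ i, p (J i) ≤ δ := by
  -- The hypothesis is applied to the rotated points, correctly labelled by the target; equivariance
  -- then moves the error back to the unrotated sample.
  set z : ι → EuclideanSpace ℝ (Fin (2 * d)) × ℤˣ := fun j => (g (x j), b j) with hz
  have hP : weightedDirac p z ∈ allDistributions (target d) := by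
    refine ⟨weightedDirac p fun j => g (x j), isProbabilityMeasure_weightedDirac hp0 hp1 _, ?_⟩
    rw [map_weightedDirac p (fun j => g (x j)) (f := fun x => (x, target d x))
      (measurable_id.prodMk measurable_target)]
    simp [hz, hb]
  have hsum := (sum_weights_le_pi_weightedDirac hp0 hp1 z _).trans (hn _ hP)
  rw [ENNReal.ofReal_le_ofReal_iff hδ] at hsum
  refine le_of_eq_of_le (Finset.sum_congr (Finset.ext fun J => ?_) fun _ _ => rfl) hsum
  simp only [Finset.mem_filter, Finset.mem_univ, true_and]
  have herr : err (weightedDirac p z) (A n fun i => z (J i)) = ENNReal.ofReal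
      (∑ j, p j * mistakeProb A (fun i => (x (J i), b (J i))) (x j) (b j)) := by
    rw [err, lintegral_weightedDirac, ENNReal.ofReal_sum_of_nonneg
      fun j _ => mul_nonneg (hp0 j) (mistakeProb_nonneg _ _ _ _)]
    refine Finset.sum_congr rfl fun j _ => ?_
    rw [ENNReal.ofReal_mul (hp0 j), ← hA.measure_apply_ne g]
  change _ ↔ ENNReal.ofReal ε < err (weightedDirac p z) (A n fun i => z (J i))
  rw [herr, ENNReal.ofReal_lt_ofReal_iff_of_nonneg hε]

theorem target_star_eq {κ : Type*} {x : κ → EuclideanSpace ℝ (Fin (2 * d))} {b : κ → ℤˣ}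
    {g : EuclideanSpace ℝ (Fin (2 * d)) ≃ₗᵢ[ℝ] EuclideanSpace ℝ (Fin (2 * d))}
    (hg : ∀ k, target d (g (x k)) = b k) (o : Option κ) :
    target d (g (o.elim 0 x)) = o.elim 1 b := by
  cases o with
  | none => simp [target_zero]
  | some k => exact hg k

variable {κ : Type*} [Fintype κ]

/-- Mass `α` spread evenly over `κ`, the remaining mass being at `none`. -/
noncomputable def starWeight (κ : Type*) [Fintype κ] (α : ℝ) (o : Option κ) : ℝ :=
  o.elim (1 - α) fun _ => α / Fintype.card κ

theorem starWeight_nonneg {α : ℝ} (h0 : 0 ≤ α) (h1 : α ≤ 1) (o : Option κ) :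
    0 ≤ starWeight κ α o := by
  cases o with
  | none => exact sub_nonneg.2 h1
  | some k => exact div_nonneg h0 (Nat.cast_nonneg _)

theorem sum_starWeight [Nonempty κ] (α : ℝ) : ∑ o, starWeight κ α o = 1 := by
  have : (Fintype.card κ : ℝ) ≠ 0 := Nat.cast_ne_zero.2 Fintype.card_ne_zero
  simp [starWeight, Fintype.sum_option]
  field_simp
  ring

theorem Suffices.log_le {A : LearningAlgorithm (EuclideanSpace ℝ (Fin (2 * d)))}
    (hA : OrthogonalEquivariant A) (hd : 1 ≤ d) {ε δ : ℝ} (hε : 0 < ε) (hε8 : ε ≤ 1 / 8)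
    (hδ : 0 < δ) {n : ℕ} (hn : Suffices A (allDistributions (target d)) ε δ n) :
    Real.log (1 / δ) ≤ 8 * ε * n := by
  classical
  obtain ⟨x, hx⟩ := exists_isometry_target_single hd
  set S₀ : Dataset (EuclideanSpace ℝ (Fin (2 * d))) n := fun _ => (0, 1) with hS₀
  obtain ⟨y, hy⟩ : ∃ y, 1 / 2 ≤ mistakeProb A S₀ x y := by
    by_contra! h
    linarith [mistakeProb_add_neg A S₀ x 1, h 1, h (-1)]
  obtain ⟨g, hg⟩ := hx y
  have hmain := hn.sum_weights_le hA hε.le hδ.le (p := starWeight Unit (4 * ε))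
    (starWeight_nonneg (by linarith) (by linarith)) (sum_starWeight _)
    (fun o => o.elim 0 fun _ => x) g (target_star_eq (b := fun _ => y) fun _ => hg)
  -- If all draws hit the origin, the output is independent of the label of `x`; for the worse label
  -- `y` the error is at least `4 * ε / 2 > ε`.
  have hpow : (1 - 4 * ε) ^ n ≤ δ := by
    refine le_trans ?_ hmain
    have hmem : (fun _ => none : Fin n → Option Unit) ∈ Finset.univ.filter
        (fun J : Fin n → Option Unit => ε < ∑ j, starWeight Unit (4 * ε) j *
          mistakeProb A (fun i => ((J i).elim 0 fun _ => x, (J i).elim 1 fun _ => y))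
            (j.elim 0 fun _ => x) (j.elim 1 fun _ => y)) := by
      rw [Finset.mem_filter]
      refine ⟨Finset.mem_univ _, ?_⟩
      rw [Fintype.sum_option]
      have h1 : 0 ≤ (1 - 4 * ε) * mistakeProb A S₀ 0 1 :=
        mul_nonneg (by linarith) (mistakeProb_nonneg _ _ _ _)
      have h2 : 4 * ε * (1 / 2) ≤ 4 * ε * mistakeProb A S₀ x y := by gcongr
      simp only [starWeight, Option.elim, Fintype.card_unit, Nat.cast_one, div_one,
        Finset.univ_unique, Finset.sum_singleton]
      change ε < (1 - 4 * ε) * mistakeProb A S₀ 0 1 + 4 * ε * mistakeProb A S₀ x y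
      linarith
    refine le_trans (le_of_eq ?_) (Finset.single_le_sum
      (f := fun J : Fin n → Option Unit => ∏ i, starWeight Unit (4 * ε) (J i))
      (fun J _ => Finset.prod_nonneg fun i _ =>
        starWeight_nonneg (by linarith) (by linarith) _) hmem)
    simp [starWeight]
  have hlog := Real.log_le_log (pow_pos (by linarith) n) hpow
  rw [Real.log_pow] at hlog
  have h1 : -(8 * ε) ≤ Real.log (1 - 4 * ε) := by
    have hpos : 0 < 1 - 4 * ε := by linarith
    refine le_trans ?_ (Real.one_sub_inv_le_log_of_pos hpos)
    have : (1 - 4 * ε)⁻¹ ≤ 1 + 8 * ε := by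
      rw [inv_le_iff_one_le_mul₀' hpos]
      nlinarith
    linarith
  have h2 : (n : ℝ) * -(8 * ε) ≤ n * Real.log (1 - 4 * ε) := by gcongr
  have h3 : Real.log (1 / δ) = -Real.log δ := by rw [one_div, Real.log_inv]
  linarith

theorem sum_star_missing [DecidableEq κ] [Nonempty κ] (α : ℝ) (n : ℕ) (k : κ) :
    ∑ J : Fin n → Option κ with ∀ i, J i ≠ some k, ∏ i, starWeight κ α (J i)
      = (1 - α / Fintype.card κ) ^ n := by
  have h := Finset.prod_univ_sum (fun _ : Fin n => (Finset.univ.erase (some k) : Finset (Option κ)))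
    (fun _ o => starWeight κ α o)
  have hset : (Fintype.piFinset fun _ : Fin n => (Finset.univ.erase (some k) : Finset (Option κ)))
      = Finset.univ.filter fun J : Fin n → Option κ => ∀ i, J i ≠ some k := by
    ext J; simp
  rw [← hset, ← h, Finset.prod_const, Finset.card_univ, Fintype.card_fin,
    Finset.sum_erase_eq_sub (Finset.mem_univ (some k)), sum_starWeight]
  rfl

/-- On a point that was not seen, the mistakes under the two possible labels balance out. -/
theorem sum_mistakeProb_unseen [DecidableEq κ] {X : Type*} (A : LearningAlgorithm X) {n : ℕ}
    (x : Option κ → X) (J : Fin n → Option κ) (k : κ) (hJ : ∀ i, J i ≠ some k) :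
    ∑ b : κ → ℤˣ, mistakeProb A (fun i => (x (J i), (J i).elim 1 b)) (x (some k)) (b k)
      = (Fintype.card (κ → ℤˣ) : ℝ) / 2 := by
  set f : (κ → ℤˣ) → ℝ := fun b =>
    mistakeProb A (fun i => (x (J i), (J i).elim 1 b)) (x (some k)) (b k) with hf
  -- Flipping the label of `k` leaves the training data unchanged and pairs complementary mistake
  -- probabilities.
  have hinv : Function.Involutive fun b : κ → ℤˣ => Function.update b k (-b k) := fun b => by
    simp
  have hflip : ∀ b, f b + f (Function.update b k (-b k)) = 1 := by
    intro b
    have hlab : ∀ i, (J i).elim 1 (Function.update b k (-b k)) = (J i).elim 1 b := by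
      intro i
      cases h : J i with
      | none => rfl
      | some k' =>
        have : k' ≠ k := fun hk => hJ i (by rw [h, hk])
        simp [this]
    simp only [hf, hlab, Function.update_self]
    exact mistakeProb_add_neg _ _ _ _
  have h1 : ∑ b, f (Function.update b k (-b k)) = ∑ b, f b :=
    Equiv.sum_comp hinv.toPerm f
  have h2 : ∑ b, f b + ∑ b, f (Function.update b k (-b k)) = Fintype.card (κ → ℤˣ) := by
    rw [← Finset.sum_add_distrib]
    simp [hflip]
  rw [h1] at h2
  linarith

theorem Suffices.card_le {A : LearningAlgorithm (EuclideanSpace ℝ (Fin (2 * d)))}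
    (hA : OrthogonalEquivariant A) {ε δ : ℝ} (hε : 0 < ε) (hε8 : ε ≤ 1 / 8) (hδ : 0 < δ)
    (hδ4 : δ ≤ 1 / 4) {n : ℕ} (hn : Suffices A (allDistributions (target d)) ε δ n) [Nonempty κ]
    (x : κ → EuclideanSpace ℝ (Fin (2 * d)))
    (hx : ∀ b : κ → ℤˣ, ∃ g : EuclideanSpace ℝ (Fin (2 * d)) ≃ₗᵢ[ℝ] EuclideanSpace ℝ (Fin (2 * d)),
      ∀ k, target d (g (x k)) = b k) :
    5 * (Fintype.card κ : ℝ) ≤ 128 * ε * n := by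
  classical
  set m : ℝ := (Fintype.card κ : ℝ) with hm
  have hm1 : 1 ≤ m := by
    rw [hm]; exact_mod_cast Fintype.card_pos (α := κ)
  set p : Option κ → ℝ := starWeight κ (8 * ε)
  have hp0 : ∀ o, 0 ≤ p o := starWeight_nonneg (by linarith) (by linarith)
  have hp1 : ∑ o, p o = 1 := sum_starWeight _
  set x' : Option κ → EuclideanSpace ℝ (Fin (2 * d)) := fun o => o.elim 0 x
  set q : (κ → ℤˣ) → (Fin n → Option κ) → κ → ℝ := fun b J k =>
    mistakeProb A (fun i => (x' (J i), (J i).elim 1 b)) (x' (some k)) (b k) with hq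
  set w : (Fin n → Option κ) → ℝ := fun J => ∏ i, p (J i) with hw
  have hw0 : ∀ J, 0 ≤ w J := fun J => Finset.prod_nonneg fun i _ => hp0 _
  have hw1 : ∑ J, w J = 1 := by
    rw [hw, ← Fintype.sum_pow, hp1, one_pow]
  have hq0 : ∀ b J k, 0 ≤ q b J k := fun b J k => mistakeProb_nonneg _ _ _ _
  -- The error on the shattered points is at most `ε` on good samples and at most `8 * ε` on bad
  -- ones, which have probability at most `1 / 4`.
  have hupper : ∀ b, ∑ J, w J * (8 * ε / m * ∑ k, q b J k) ≤ 11 / 4 * ε := by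
    intro b
    obtain ⟨g, hg⟩ := hx b
    have hbad := hn.sum_weights_le hA hε.le hδ.le hp0 hp1 x' g (target_star_eq hg)
    set bad : (Fin n → Option κ) → Prop := fun J => ε < ∑ j, p j *
      mistakeProb A (fun i => (x' (J i), (J i).elim 1 b)) (x' j) (j.elim 1 b) with hbaddef
    have hpoint : ∀ J, w J * (8 * ε / m * ∑ k, q b J k)
        ≤ ε * w J + 7 * ε * (if bad J then w J else 0) := by
      intro J
      have hmax : 8 * ε / m * ∑ k, q b J k ≤ 8 * ε := by
        have : ∑ k, q b J k ≤ m := by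
          calc ∑ k, q b J k ≤ ∑ _k : κ, (1 : ℝ) :=
                Finset.sum_le_sum fun k _ => mistakeProb_le_one _ _ _ _
            _ = m := by simp [hm]
        calc 8 * ε / m * ∑ k, q b J k ≤ 8 * ε / m * m := by gcongr
          _ = 8 * ε := by field_simp
      by_cases hJ : bad J
      · rw [if_pos hJ]
        have := mul_le_mul_of_nonneg_left hmax (hw0 J)
        linarith
      · rw [if_neg hJ]
        have hle : 8 * ε / m * ∑ k, q b J k ≤ ε := by
          refine le_trans ?_ (not_lt.1 hJ)
          rw [Fintype.sum_option, Finset.mul_sum]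
          exact le_add_of_nonneg_left (mul_nonneg (hp0 _) (mistakeProb_nonneg _ _ _ _))
        have := mul_le_mul_of_nonneg_left hle (hw0 J)
        linarith
    calc ∑ J, w J * (8 * ε / m * ∑ k, q b J k)
        ≤ ∑ J, (ε * w J + 7 * ε * (if bad J then w J else 0)) :=
          Finset.sum_le_sum fun J _ => hpoint J
      _ = ε + 7 * ε * ∑ J with bad J, w J := by
          rw [Finset.sum_add_distrib, ← Finset.mul_sum, ← Finset.mul_sum, hw1, mul_one,
            Finset.sum_filter]
      _ ≤ ε + 7 * ε * (1 / 4) := by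
          gcongr
          exact hbad.trans hδ4
      _ = 11 / 4 * ε := by ring
  set N : ℝ := (Fintype.card (κ → ℤˣ) : ℝ) with hN
  have hNpos : 0 < N := by
    rw [hN]; exact_mod_cast Fintype.card_pos (α := κ → ℤˣ)
  have hlower : 8 * ε / m * (m * ((1 - 8 * ε / m) ^ n * (N / 2)))
      ≤ ∑ b, ∑ J, w J * (8 * ε / m * ∑ k, q b J k) := by
    have hk : ∀ k, (1 - 8 * ε / m) ^ n * (N / 2) ≤ ∑ J, w J * ∑ b, q b J k := by
      intro k
      rw [← sum_star_missing (8 * ε) n k, Finset.sum_mul]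
      calc _ = ∑ J : Fin n → Option κ with ∀ i, J i ≠ some k, w J * ∑ b, q b J k := by
            refine Finset.sum_congr rfl fun J hJ => ?_
            rw [hq, sum_mistakeProb_unseen A x' J k (Finset.mem_filter.1 hJ).2]
        _ ≤ ∑ J, w J * ∑ b, q b J k :=
            Finset.sum_le_univ_sum_of_nonneg fun J =>
              mul_nonneg (hw0 J) (Finset.sum_nonneg fun b _ => hq0 b J k)
    calc 8 * ε / m * (m * ((1 - 8 * ε / m) ^ n * (N / 2)))
        = 8 * ε / m * ∑ _k : κ, (1 - 8 * ε / m) ^ n * (N / 2) := by simp [hm]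
      _ ≤ 8 * ε / m * ∑ k, ∑ J, w J * ∑ b, q b J k := by
          gcongr with k
          exact hk k
      _ = ∑ b, ∑ J, w J * (8 * ε / m * ∑ k, q b J k) := by
          rw [Finset.sum_comm, Finset.sum_comm (s := (Finset.univ : Finset (κ → ℤˣ))),
            Finset.mul_sum]
          refine Finset.sum_congr rfl fun J _ => ?_
          simp only [Finset.mul_sum]
          rw [Finset.sum_comm]
          exact Finset.sum_congr rfl fun b _ => Finset.sum_congr rfl fun k _ => by ring
  have htotal : ∑ b, ∑ J, w J * (8 * ε / m * ∑ k, q b J k) ≤ N * (11 / 4 * ε) := by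
    calc _ ≤ ∑ _b : κ → ℤˣ, 11 / 4 * ε := Finset.sum_le_sum fun b _ => hupper b
      _ = N * (11 / 4 * ε) := by simp [hN]
  -- The average error over labels is at least `4 * ε` times the chance that a given point is
  -- unseen; comparing with `11 / 4 * ε` gives the ratio.
  have hpow : (1 - 8 * ε / m) ^ n ≤ 11 / 16 := by
    have h := hlower.trans htotal
    have h1 : ∀ t, 8 * ε / m * (m * (t * (N / 2))) = 4 * ε * N * t := fun t => by
      field_simp
      ring
    have h2 : N * (11 / 4 * ε) = 4 * ε * N * (11 / 16) := by ring
    rw [h1, h2] at h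
    exact le_of_mul_le_mul_left h (by positivity)
  have hsmall : 8 * ε / m ≤ 1 := by
    rw [div_le_one (by linarith)]; linarith
  have hbern : 1 + n * -(8 * ε / m) ≤ (1 - 8 * ε / m) ^ n := by
    have := one_add_mul_le_pow (a := -(8 * ε / m)) (by linarith) n
    rwa [← sub_eq_add_neg] at this
  have h5 : 5 / 16 ≤ n * (8 * ε / m) := by linarith
  have h6 : n * (8 * ε / m) * m = n * (8 * ε) := by field_simp
  have h7 : 5 / 16 * m ≤ n * (8 * ε / m) * m := by gcongr
  linarith

theorem le_of_suffices {A : LearningAlgorithm (EuclideanSpace ℝ (Fin (2 * d)))}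
    (hA : OrthogonalEquivariant A) (hd : 1 ≤ d) {ε δ : ℝ} (hε : 0 < ε) (hε8 : ε ≤ 1 / 8)
    (hδ : 0 < δ) (hδ4 : δ ≤ 1 / 4) {n : ℕ}
    (hn : Suffices A (allDistributions (target d)) ε δ n) :
    1 / 120 * (((d : ℝ) ^ 2 + Real.log (1 / δ)) / ε) ≤ n := by
  have hlog := hn.log_le hA hd hε hε8 hδ
  have hlog1 : 1 ≤ Real.log (1 / δ) := by
    have h4 : Real.log 4 ≤ Real.log (1 / δ) :=
      Real.log_le_log (by norm_num) (by rw [le_div_iff₀ hδ]; linarith)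
    have : Real.log 4 = 2 * Real.log 2 := by
      rw [show (4 : ℝ) = 2 ^ 2 by norm_num, Real.log_pow]; norm_num
    linarith [Real.log_two_gt_d9]
  have hpos : 0 ≤ ε * n := by positivity
  -- For `d ≥ 2`, `d ^ 2` is at most four times the number of index pairs. For `d = 1` there are no
  -- pairs, and the logarithmic bound suffices because `δ ≤ 1 / 4` makes `log (1 / δ) ≥ 1`.
  have hsq : (d : ℝ) ^ 2 ≤ 104 * (ε * n) := by
    rcases hd.eq_or_lt with rfl | hd2
    · simp; linarith
    · have hcard := card_indexPair_mul_two d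
      have : Nonempty (IndexPair d) := ⟨⟨⟨1, hd2⟩, ⟨0, one_pos⟩⟩⟩
      have h := hn.card_le hA hε hε8 hδ hδ4 pairPoint exists_isometry_target_pairPoint
      have hcard' : (Fintype.card (IndexPair d) : ℝ) * 2 = d * (d - 1) := by
        rw [← Nat.cast_one (R := ℝ), ← Nat.cast_sub hd]
        exact_mod_cast hcard
      have hd2' : (2 : ℝ) ≤ d := by exact_mod_cast hd2
      nlinarith
  rw [← mul_div_assoc, div_le_iff₀ hε]
  linarith

theorem le_sampleComplexity {A : LearningAlgorithm (EuclideanSpace ℝ (Fin (2 * d)))}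
    (hA : OrthogonalEquivariant A) (hd : 1 ≤ d) {ε δ : ℝ} (hε : 0 < ε) (hε8 : ε ≤ 1 / 8)
    (hδ : 0 < δ) (hδ4 : δ ≤ 1 / 4) :
    ENNReal.ofReal (1 / 120 * (((d : ℝ) ^ 2 + Real.log (1 / δ)) / ε)) ≤
      ((sampleComplexity A (allDistributions (target d)) ε δ : ℕ∞) : ℝ≥0∞) := by
  rcases Set.eq_empty_or_nonempty {n | Suffices A (allDistributions (target d)) ε δ n} with h | h
  · have : sampleComplexity A (allDistributions (target d)) ε δ = ⊤ := by
      change sInf ((fun n : ℕ => (n : ℕ∞)) ''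
        {n | Suffices A (allDistributions (target d)) ε δ n}) = ⊤
      rw [h, Set.image_empty, sInf_empty]
    simp [this]
  · obtain ⟨n, hn, heq⟩ := csInf_mem (h.image fun n : ℕ => (n : ℕ∞))
    have : sampleComplexity A (allDistributions (target d)) ε δ = n := heq.symm
    rw [this, ENat.toENNReal_coe, ← ENNReal.ofReal_natCast]
    exact ENNReal.ofReal_le_ofReal (le_of_suffices hA hd hε hε8 hδ hδ4 hn)

end LowerBound

end ConvSep

theorem theorem3p1 :
    -- lower bound for every orthogonal equivariant algorithm
    (∃ c : ℝ, 0 < c ∧ ∀ d : ℕ, 1 ≤ d →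
      ∀ A : ConvSep.LearningAlgorithm (EuclideanSpace ℝ (Fin (2 * d))),
        ConvSep.OrthogonalEquivariant A →
        ∀ ε δ : ℝ, 0 < ε → ε ≤ 1 / 8 → 0 < δ → δ ≤ 1 / 4 →
          ENNReal.ofReal (c * (((d : ℝ) ^ 2 + Real.log (1 / δ)) / ε)) ≤
            ((ConvSep.sampleComplexity A
              (ConvSep.allDistributions (ConvSep.target d)) ε δ : ℕ∞) : ℝ≥0∞)) ∧
    -- upper bound for every empirical risk minimizer over the 2-layer CNN with one filter of
    -- width 1, square activation and sum pooling over the two halves of the input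
    (∃ C : ℝ, 0 < C ∧ ∀ d : ℕ, 1 ≤ d →
      ∀ A : (n : ℕ) → ConvSep.Dataset (EuclideanSpace ℝ (Fin (2 * d))) n →
          (EuclideanSpace ℝ (Fin (2 * d)) → ℤˣ),
        ConvSep.IsERM (ConvSep.cnnClass 1 2 d ConvSep.squarePool) A →
        ∀ ε δ : ℝ, 0 < ε → ε ≤ 1 / 2 → 0 < δ → δ < 1 →
          ((ConvSep.sampleComplexity (ConvSep.deterministic A)
              (ConvSep.allDistributions (ConvSep.target d)) ε δ : ℕ∞) : ℝ≥0∞) ≤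
            ENNReal.ofReal (C * (1 / ε * (Real.log (1 / ε) + Real.log (1 / δ))))) ∧
    -- gradient descent on the same CNN from Gaussian initialization finds an empirical risk
    -- minimizer, of training error zero, on all training data labelled by the target
    (∀ d : ℕ, 1 ≤ d → ∀ ℓ : ℝ → ℝ, ConvSep.IsSurrogateLoss ℓ →
      ∀ᵐ W₀ ∂(ConvSep.gaussianInit 1 2),
        ∀ (n : ℕ) (S : ConvSep.Dataset (EuclideanSpace ℝ (Fin (2 * d))) n),
          (∀ i, (S i).2 = ConvSep.target d (S i).1) →
          ∃ η₀ : ℝ, 0 < η₀ ∧ ∀ η : ℝ, 0 < η → η < η₀ →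
            Tendsto (fun T : ℕ => ConvSep.trainLoss ℓ ConvSep.squarePool S
                ((ConvSep.gdStep ℓ ConvSep.squarePool S η)^[T] W₀)) atTop (𝓝 0) ∧
            ∀ᶠ T : ℕ in atTop,
              (∀ i, ConvSep.sgn (ConvSep.cnn ConvSep.squarePool
                ((ConvSep.gdStep ℓ ConvSep.squarePool S η)^[T] W₀) (S i).1) = (S i).2) ∧
              ConvSep.IsEmpiricalRiskMinimizer (ConvSep.cnnClass 1 2 d ConvSep.squarePool) S
                (fun x => ConvSep.sgn (ConvSep.cnn ConvSep.squarePool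
                  ((ConvSep.gdStep ℓ ConvSep.squarePool S η)^[T] W₀) x))) := by
  exact ⟨⟨1 / 120, by norm_num, fun d hd A hA ε δ hε hε8 hδ hδ4 =>
      ConvSep.le_sampleComplexity hA hd hε hε8 hδ hδ4⟩,
    ⟨130, by norm_num, fun d _ A hA ε δ hε hε2 hδ hδ1 =>
      ConvSep.sampleComplexity_le_of_isERM A hA hε hε2 hδ hδ1⟩,
    fun d _ ℓ hℓ => by
      filter_upwards [ConvSep.ae_gaussianInit_ne_zero] with W₀ hW₀ n S hS
      exact ConvSep.gradientDescent_finds_erm ℓ hℓ W₀ hW₀ S hS⟩
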